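/- **Setting.** Let $G$ be a group with a fixed enumeration $s_1,\dots,s_Q$ of a finite generating set closed under inverses, with word length $|x|$ and word metric $d(x,y)=|x^{-1}y|$; let $\delta\ge 1$ be such that $(G,d)$ is $\delta$-hyperbolic in the sense of Gromov, i.e. $(x|z)_w\ge\min((x|y)_w,(y|z)_w)-\delta$ for all $x,y,z,w$. **The $B$-type.** Fix natural numbers $N$ and $M$. The ball type $T^b_N(x)$ is the function $y\mapsto |xy|-|x|$ on $\{|y|\le N\}$. The $Z$-type $T^Z(x)$ is $T^b_N(x)$ if $|x|\ge M$, while elements of length $<M$ get pairwise distinct further values. The p-parent of $y\ne e$ is $ys_i$ with $i$ least such that $|ys_i|=|y|-1$; $y^{\uparrow k}$ denotes the $k$-fold p-parent ($k\le|y|$), and $x$ is a p-grandchild of $g$ if $|x|=|g|+M$ and $x^{\uparrow M}=g$. For every value $\tau$ of $T^Z$ choose a representative $g_\tau$ and an enumeration of the p-grandchildren of $g_\tau$. If $|g|\ge M$, $h=g^{\uparrow M}$ and $\tau=T^Z(h)$, let $n_g$ be the number of $g_\tau h^{-1}g$ in this enumeration; if $|g|<M$, let $n_g=0$. Put $T^A(g)=(T^Z(g),n_g)$.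 Let $R$ be the maximum of $16\delta$ and of all $|t^n|$, where $n\in\mathbb Z$ and $t$ is a torsion element with $|t|\le16\delta$; the set of cousins of $g$ is $C_g=\{g' : |g'|=|g|,\ d(g,g')\le R\}$. For distinct $g',g''\in C_g$ let $k_{g',g''}$ be the least $k$ such that $g'^{\uparrow Mk}$ and $g''^{\uparrow Mk}$ exist and have different $A$-types, and let $k_1>k_2>\dots>k_r$ be the elements of $\{k_{g',g''}\}\cup\{0\}$. Then $$T^B(g)=\{(g^{-1}g',\,(T^A(g'^{\uparrow Mk_1}),\dots,T^A(g'^{\uparrow Mk_r}))) : g'\in C_g\}.$$ **Systems of covers.** Let $X$ be a compact metric space with an action of $G$ by homeomorphisms. A family $(U_x)_{x\in G}$ of subsets of $X$ is a *system of covers* if $\{U_x : |x|=n\}$ is an open cover of $X$ for every $n\ge0$. It is *quasi-$G$-invariant* with respect to a function $T$ on $G$ with values in a finite set, with neighbourhood constant $D>0$ and jump constant $J\in\{1,2,\dots\}$, if: (1) $\max_{|x|=n}\operatorname{diam}U_x\to0$; (2) $|x|=|y|$ and $U_x\cap U_y\ne\emptyset$ imply $d(x,y)\le D$; (3) for every $x$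 and $0<k\le|x|/J$ there is $y$ with $|y|=|x|-kJ$ and $U_x\subseteq U_y$; (4) whenever $T(x)=T(gx)$: $U_{gx}=gU_x$; if $|y|=|x|$ and $U_x\cap U_y\neq\emptyset$, then $U_{gy}=gU_y$ and $|gy|=|gx|$; and if $|y|=|x|+kJ$ with $k>0$ and $\emptyset\ne U_y\subseteq U_x$, then $|gy|=|gx|+kJ$, $T(gy)=T(y)$ and $U_{gy}=gU_y$. For a positive multiple $L$ of $J$, let $K_n$ be the nerve of the cover $\widetilde{\mathcal U}_{nL}$ of $X$ by the nonempty sets among the $U_x$ with $|x|=nL$, and let $f_n:K_{n+1}\to K_n$ be the map, affine on every simplex, which sends the vertex of $U$ to the barycentre of the simplex spanned by all $V\in\widetilde{\mathcal U}_{nL}$ with $V\supseteq U$. For a simplex $s$ of $K_n$ let $V_s$ be the set of all $g\in G$ with $|g|=nL$ such that $U_g$ is a vertex of $s$. Simplexes $s\in K_n$, $s'\in K_{n'}$ have the same $T^\Delta$-type if there is a bijection $\varphi:V_s\to V_{s'}$ with $T(\varphi(g))=T(g)$ and $\varphi(g)^{-1}\varphi(g')=g^{-1}g'$ for all $g,g'\in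 V_s$. **Markov systems.** An inverse sequence of polyhedra $(K_n,f_n)$, with a function $T'$ from the simplexes of all $K_n$ to a finite set (simplex types), is *Markov* if the $K_n$ are finite simplicial complexes of uniformly bounded dimension, $f_n$ maps every simplex affinely into a simplex, and for simplexes $s\in K_i$, $s'\in K_j$ of the same type there are isomorphisms of subcomplexes $i_k:(f_i\circ\dots\circ f_{i+k-1})^{-1}(s)\to(f_j\circ\dots\circ f_{j+k-1})^{-1}(s')$, $k\ge0$, which preserve the types of simplexes and satisfy $i_k\circ f_{i+k}=f_{j+k}\circ i_{k+1}$. It is *barycentric* if $f_n$ maps every vertex of $K_{n+1}$ to the barycentre of some simplex of $K_n$. It has the *distinct types property* if for every $n$ and every simplex $s\in K_n$ all simplexes of the subcomplex $f_n^{-1}(s)$ have pairwise distinct types. It is *finitely describable* if there is a computable procedure such that for every $N'$ for which $K_0,\dots,K_{N'}$ contain simplexes of all occurring types, the procedure, given any finite code of the initial part $K_0\leftarrow\dots\leftarrow K_{N'+1}$ (with simplex types), produces codes of all stages of every barycentric Markov system with distinct types property that has this initial part and all of whose types occur in its complexes $0,\dots,N'$; in particular such a system is determined by that initial part uniquely up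 to isomorphism. **Theorem.** There is $N_1$, depending only on $G$, its generators and $\delta$, such that the following holds for all $N\ge N_1$, all $M\ge\max(N+4\delta,\,14\delta,\,R/2+4\delta)$ and all choices made in the definition of $T^B$. Let $(U_x)_{x\in G}$ be a quasi-$G$-invariant system of covers of a compact metric $G$-space $X$, with a type function $T$ stronger than $T^B$ (i.e. $T(x)=T(y)$ implies $T^B(x)=T^B(y)$), a neighbourhood constant $D\le16\delta$ and a jump constant $J$. Let $L$ be a positive multiple of $J$ and let $(K_n,f_n)$ be the system of nerves defined above. Then there is a function $T'$ from the simplexes of all $K_n$ to a finite set which is stronger than $T^\Delta$ (simplexes of equal $T'$-type have equal $T^\Delta$-type) and such that $(K_n,f_n)$ with the simplex types $T'$ is Markov and has the distinct types property. This system is moreover barycentric, and with the types $T'$ it is finitely describable. -/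

import Mathlib

open scoped Pointwise

namespace MarkovNerve

noncomputable section

/-! ## Simplicial complexes and inverse systems of polyhedra -/

section Polyhedra

universe u

variable {V W : Type*}

/-- The closed simplex spanned by the vertices in `s`, in barycentric coordinates. -/
def closedSimplex (s : Finset V) : Set (V → ℝ) :=
  {p | (∀ v, 0 ≤ p v) ∧ (∀ v, v ∉ s → p v = 0) ∧ ∑ v ∈ s, p v = 1}

/-- The underlying polyhedron of an abstract simplicial complex, in barycentric coordinates. -/
def realization (K : PreAbstractSimplicialComplex V) : Set (V → ℝ) :=
  {p | ∃ s ∈ K.faces, p ∈ closedSimplex s}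

/-- The barycentre of the simplex spanned by `s`. -/
def barycentre (s : Finset V) : V → ℝ :=
  Set.indicator (s : Set V) (fun _ => ((s.card : ℝ))⁻¹)

open Classical in
/-- The point of a polyhedron given by a vertex. -/
def vertexPoint (v : V) : V → ℝ := Pi.single v 1

/-- The affine extension of an assignment `b` of points to vertices:
the point with barycentric coordinates `p v` is sent to `∑ v, p v • b v`. -/
def affineExtension (b : V → W → ℝ) (p : V → ℝ) : W → ℝ :=
  fun w => ∑ᶠ v, p v * b v w

/-- The affine extension of a vertex map. -/
def simplicialExtension (φ : V → W) : (V → ℝ) → (W → ℝ) :=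
  affineExtension (fun v => vertexPoint (φ v))

/-- An inverse sequence of polyhedra. The vertices of `K n` are the `v : V n` with `{v}` a face;
`V n` may have other elements. Continuity of the maps is automatic for finite complexes
and maps which are affine on simplexes. -/
structure PolyhedralSystem where
  V : ℕ → Type u
  nonempty : ∀ n, Nonempty (V n)
  K : ∀ n, PreAbstractSimplicialComplex (V n)
  f : ∀ n, realization (K (n + 1)) → realization (K n)

namespace PolyhedralSystem

variable (A : PolyhedralSystem.{u})

/-- The composition `f i ∘ f (i+1) ∘ ⋯ ∘ f (i+k-1)`. -/
def comp (i : ℕ) : ∀ k, realization (A.K (i + k)) → realization (A.K i)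
  | 0 => id
  | k + 1 => comp i k ∘ A.f (i + k)

/-- The simplexes of the subcomplex which is the preimage of the closed simplex `s` under `g`. -/
def preimageFaces {K : PreAbstractSimplicialComplex V} {K' : PreAbstractSimplicialComplex W}
    (g : realization K → realization K') (s : Finset W) : Set (Finset V) :=
  {σ | σ ∈ K.faces ∧
    ∀ p : realization K, (p : V → ℝ) ∈ closedSimplex σ → (g p : W → ℝ) ∈ closedSimplex s}

open Classical in
/-- The vertex map `φ` induces an isomorphism from the subcomplex with set of simplexes `P` onto
the subcomplex with set of simplexes `P'`. -/
def IsSubcomplexIso (P : Set (Finset V)) (P' : Set (Finset W)) (φ : V → W) : Prop :=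
  Set.InjOn φ {v | {v} ∈ P} ∧ Set.BijOn (fun σ : Finset V => σ.image φ) P P'

/-- A function on the simplexes of all the complexes of the system. It is a type function when
its codomain is finite. -/
abbrev SimplexTypes (𝒯 : Type*) := ∀ n, (A.K n).faces → 𝒯

/-- Every simplex of `K (n+1)` is mapped affinely into some simplex of `K n`. -/
def IsAffineSystem : Prop :=
  ∀ n, ∀ σ ∈ (A.K (n + 1)).faces,
    (∃ s ∈ (A.K n).faces, σ ∈ preimageFaces (A.f n) s) ∧
    ∀ (p q r : realization (A.K (n + 1))) (t : ℝ), 0 ≤ t → t ≤ 1 →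
      (p : A.V (n + 1) → ℝ) ∈ closedSimplex σ → (q : A.V (n + 1) → ℝ) ∈ closedSimplex σ →
      (r : A.V (n + 1) → ℝ) = (1 - t) • (p : A.V (n + 1) → ℝ) + t • (q : A.V (n + 1) → ℝ) →
      (A.f n r : A.V n → ℝ) =
        (1 - t) • (A.f n p : A.V n → ℝ) + t • (A.f n q : A.V n → ℝ)

open Classical in
/-- The ladder condition for simplexes `s`, `s'`: type preserving isomorphisms between the
successive preimages of `s` and those of `s'` which commute with the bonding maps. -/
def Ladder {𝒯 : Type*} (T : A.SimplexTypes 𝒯) {i j : ℕ}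
    (s : (A.K i).faces) (s' : (A.K j).faces) : Prop :=
  ∃ φ : ∀ k, A.V (i + k) → A.V (j + k),
    (∀ k, IsSubcomplexIso (preimageFaces (A.comp i k) s.1) (preimageFaces (A.comp j k) s'.1)
      (φ k)) ∧
    (∀ k (σ : (A.K (i + k)).faces) (σ' : (A.K (j + k)).faces),
      σ.1 ∈ preimageFaces (A.comp i k) s.1 → σ'.1 = σ.1.image (φ k) →
        T (j + k) σ' = T (i + k) σ) ∧
    ∀ k (p : realization (A.K (i + (k + 1)))) (q : realization (A.K (j + (k + 1)))),
      (A.comp i (k + 1) p : A.V i → ℝ) ∈ closedSimplex s.1 →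
      (q : A.V (j + (k + 1)) → ℝ) = simplicialExtension (φ (k + 1)) p →
        (A.f (j + k) q : A.V (j + k) → ℝ) = simplicialExtension (φ k) (A.f (i + k) p)

/-- The Markov property of the system equipped with the simplex types `T`. -/
structure IsMarkov {𝒯 : Type*} (T : A.SimplexTypes 𝒯) : Prop where
  finite_types : Finite 𝒯
  finite_complex : ∀ n, (A.K n).faces.Finite
  dim_bounded : ∃ d : ℕ, ∀ n, ∀ s ∈ (A.K n).faces, s.card ≤ d + 1
  affine : A.IsAffineSystem
  ladder : ∀ (i j : ℕ) (s : (A.K i).faces) (s' : (A.K j).faces), T i s = T j s' → A.Ladder T s s'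

/-- Vertices of `K (n+1)` are mapped to vertices of the first barycentric subdivision of `K n`. -/
def IsBarycentric : Prop :=
  ∀ n (v : A.V (n + 1)) (p : realization (A.K (n + 1))), (p : A.V (n + 1) → ℝ) = vertexPoint v →
    ∃ s ∈ (A.K n).faces, (A.f n p : A.V n → ℝ) = barycentre s

/-- All simplexes in the preimage of any simplex have pairwise distinct types. -/
def HasDistinctTypes {𝒯 : Type*} (T : A.SimplexTypes 𝒯) : Prop :=
  ∀ n (s : (A.K n).faces) (σ σ' : (A.K (n + 1)).faces),
    σ.1 ∈ preimageFaces (A.f n) s.1 → σ'.1 ∈ preimageFaces (A.f n) s.1 →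
      T (n + 1) σ = T (n + 1) σ' → σ = σ'

/-! ### Finite describability -/

/-- The code of one stage `K n ← K (n-1)` of a barycentric system with simplex types: a list of
simplexes (given by lists of labels of vertices) with their types, and a list assigning to the
label of each vertex the simplex of the preceding complex to whose barycentre it is mapped. -/
abbrev StageCode := List (List ℕ × ℕ) × List (ℕ × List ℕ)

open Classical in
/-- The list `l` encodes the bonding map `f n` on vertices, where `ν` labels the vertices. -/
def CodesParents (ν : ∀ n, A.V n → ℕ) (n : ℕ) (l : List (ℕ × List ℕ)) : Prop :=
  let IsEntry (v : A.V (n + 1)) (s : Finset (A.V n)) (e : ℕ × List ℕ) : Prop :=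
    e.1 = ν (n + 1) v ∧ e.2.toFinset = s.image (ν n)
  let IsParent (v : A.V (n + 1)) (s : Finset (A.V n)) : Prop :=
    s ∈ (A.K n).faces ∧ ∃ p : realization (A.K (n + 1)),
      (p : A.V (n + 1) → ℝ) = vertexPoint v ∧ (A.f n p : A.V n → ℝ) = barycentre s
  (∀ v s, IsParent v s → ∃ e ∈ l, IsEntry v s e) ∧ ∀ e ∈ l, ∃ v s, IsParent v s ∧ IsEntry v s e

open Classical in
/-- The code `c` describes the stage `n` of the system with simplex types `T`, where `ν` labels the
vertices. -/
def CodesStage {m : ℕ} (T : A.SimplexTypes (Fin m)) (ν : ∀ n, A.V n → ℕ) (n : ℕ)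
    (c : StageCode) : Prop :=
  Set.InjOn (ν n) {v | {v} ∈ (A.K n).faces} ∧
  (∀ s : (A.K n).faces, ∃ e ∈ c.1, e.1.toFinset = s.1.image (ν n) ∧ e.2 = (T n s : ℕ)) ∧
  (∀ e ∈ c.1, ∃ s : (A.K n).faces, e.1.toFinset = s.1.image (ν n) ∧ e.2 = (T n s : ℕ)) ∧
  match n with
  | 0 => c.2 = []
  | n + 1 => A.CodesParents ν n c.2

/-- The list `l` describes the initial part of the system, of as many stages as the list has. -/
def CodesInitialPart {m : ℕ} (T : A.SimplexTypes (Fin m)) (ν : ∀ n, A.V n → ℕ)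
    (l : List StageCode) : Prop :=
  ∀ n (h : n < l.length), A.CodesStage T ν n (l.get ⟨n, h⟩)

/-- Simplexes of all types which occur in the system occur in the complexes `K 0, …, K N`. -/
def AllTypesUpTo {𝒯 : Type*} (T : A.SimplexTypes 𝒯) (N : ℕ) : Prop :=
  ∀ n (s : (A.K n).faces), ∃ k ≤ N, ∃ σ : (A.K k).faces, T k σ = T n s

/-- The system (with its simplex types) is uniquely determined by a finite set of data, and can be
algorithmically rebuilt from it: there is a computable procedure such that, whenever `K 0, …, K N`
contain simplexes of all types, it produces, out of any code of the initial part
`K 0 ← ⋯ ← K (N+1)`, the codes of all stages of every barycentric Markov system `B` with distinct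
types property which has the same initial part (and all of whose types occur up to `N`). -/
def FinitelyDescribable {m : ℕ} (T : A.SimplexTypes (Fin m)) : Prop :=
  ∃ rebuild : List StageCode → ℕ → StageCode, Computable₂ rebuild ∧
    ∀ N, A.AllTypesUpTo T N → ∀ c : List StageCode, c.length = N + 2 →
      (∃ ν, A.CodesInitialPart T ν c) →
      ∀ (B : PolyhedralSystem.{u}) (m' : ℕ) (T' : B.SimplexTypes (Fin m')),
        B.IsMarkov T' → B.IsBarycentric → B.HasDistinctTypes T' → B.AllTypesUpTo T' N →
        ∀ ν₀, B.CodesInitialPart T' ν₀ c →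
          ∃ ν : ∀ n, B.V n → ℕ,
            (∀ n ≤ N + 1, ∀ v, {v} ∈ (B.K n).faces → ν n v = ν₀ n v) ∧
            ∀ n, B.CodesStage T' ν n (rebuild c n)

end PolyhedralSystem

end Polyhedra

/-! ## Systems of nerves of covers -/

section Nerves

variable {X : Type*}

/-- The nerve of a family of sets. -/
def nerve (𝒰 : Set (Set X)) : PreAbstractSimplicialComplex (Set X) where
  faces := {σ | σ.Nonempty ∧ (σ : Set (Set X)) ⊆ 𝒰 ∧ (⋂₀ (σ : Set (Set X))).Nonempty}
  isRelLowerSet_faces := by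
    rintro σ ⟨h1, h2, h3⟩
    refine ⟨h1, fun τ hτ hne => ⟨hne, ?_, ?_⟩⟩
    · exact fun x hx => h2 (hτ hx)
    · exact h3.mono (Set.sInter_subset_sInter (fun x hx => hτ hx))

open Classical in
/-- The members of a finite family `𝒰` which contain `u`. -/
def parents {𝒰 : Set (Set X)} (h : 𝒰.Finite) (u : Set X) : Finset (Set X) :=
  h.toFinset.filter (fun w => u ⊆ w)

theorem barycentre_mem {V : Type*} {s τ : Finset V} (hs : s.Nonempty) (h : s ⊆ τ) :
    barycentre s ∈ closedSimplex τ := by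
  classical
  refine ⟨fun v => Set.indicator_nonneg (fun _ _ => by positivity) v, fun v hv => ?_, ?_⟩
  · exact Set.indicator_of_notMem (fun hh => hv (h hh)) _
  · have : ∑ v ∈ τ, barycentre s v = ∑ v ∈ s, barycentre s v := by
      refine (Finset.sum_subset h fun v _ hv => ?_).symm
      exact Set.indicator_of_notMem (fun hh => hv hh) _
    have h2 : ∀ v ∈ s, barycentre s v = ((s.card : ℝ))⁻¹ := fun v hv =>
      Set.indicator_of_mem (s := (s : Set V)) hv _
    rw [this, Finset.sum_congr rfl h2]
    have : (s.card : ℝ) ≠ 0 := by exact_mod_cast hs.card_pos.ne'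
    simp [this]

theorem affineExtension_eq_sum {V W : Type*} (b : V → W → ℝ) {σ : Finset V} {p : V → ℝ}
    (hp : p ∈ closedSimplex σ) (w : W) : affineExtension b p w = ∑ v ∈ σ, p v * b v w := by
  refine finsum_eq_sum_of_support_subset _ fun v hv => ?_
  by_contra hn
  exact hv (by simp [hp.2.1 v hn])

theorem affineExtension_mem {V W : Type*} {b : V → W → ℝ} {σ : Finset V} {τ : Finset W}
    {p : V → ℝ} (hp : p ∈ closedSimplex σ) (hb : ∀ v ∈ σ, b v ∈ closedSimplex τ) :
    affineExtension b p ∈ closedSimplex τ := by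
  refine ⟨fun w => ?_, fun w hw => ?_, ?_⟩
  · rw [affineExtension_eq_sum b hp]
    exact Finset.sum_nonneg fun v hv => mul_nonneg (hp.1 v) ((hb v hv).1 w)
  · rw [affineExtension_eq_sum b hp]
    exact Finset.sum_eq_zero fun v hv => by rw [(hb v hv).2.1 w hw, mul_zero]
  · rw [Finset.sum_congr rfl (fun w _ => affineExtension_eq_sum b hp w), Finset.sum_comm,
      ← hp.2.2]
    refine Finset.sum_congr rfl fun v hv => ?_
    rw [← Finset.mul_sum, (hb v hv).2.2, mul_one]

theorem nerveMap_mem {𝒰 𝒱 : Set (Set X)} (h𝒱 : 𝒱.Finite)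
    (href : ∀ u ∈ 𝒰, ∃ w ∈ 𝒱, u ⊆ w) {p : Set X → ℝ} (hp : p ∈ realization (nerve 𝒰)) :
    affineExtension (fun u => barycentre (parents h𝒱 u)) p ∈ realization (nerve 𝒱) := by
  classical
  obtain ⟨σ, ⟨hne, hsub, y, hy⟩, hp⟩ := hp
  have hpar : ∀ u ∈ σ, (parents h𝒱 u).Nonempty := fun u hu => by
    obtain ⟨w, hw, huw⟩ := href u (hsub hu)
    exact ⟨w, by simp [parents, hw, huw]⟩
  refine ⟨σ.biUnion (parents h𝒱), ⟨?_, ?_, y, ?_⟩, affineExtension_mem hp fun u hu =>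
    barycentre_mem (hpar u hu) (Finset.subset_biUnion_of_mem _ hu)⟩
  · obtain ⟨u, hu⟩ := hne
    exact (hpar u hu).mono (Finset.subset_biUnion_of_mem _ hu)
  · intro w hw
    simp only [Finset.coe_biUnion, Set.mem_iUnion, Finset.mem_coe, parents, Finset.mem_filter,
      Set.Finite.mem_toFinset] at hw
    obtain ⟨_, _, h, _⟩ := hw
    exact h
  · intro w hw
    simp only [Finset.coe_biUnion, Set.mem_iUnion, Finset.mem_coe, parents, Finset.mem_filter,
      Set.Finite.mem_toFinset] at hw
    obtain ⟨u, hu, _, h⟩ := hw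
    exact h (hy u hu)

/-- The system of nerves of a sequence of finite families of sets, each refining the previous one:
the bonding map sends the vertex of `u` to the barycentre of the simplex spanned by the members of
the previous family which contain `u`, and it is affine on simplexes. -/
def nerveSystem (𝒰 : ℕ → Set (Set X)) (hfin : ∀ n, (𝒰 n).Finite)
    (href : ∀ n, ∀ u ∈ 𝒰 (n + 1), ∃ w ∈ 𝒰 n, u ⊆ w) : PolyhedralSystem where
  V _ := Set X
  nonempty _ := ⟨∅⟩
  K n := nerve (𝒰 n)
  f n p := ⟨affineExtension (fun u => barycentre (parents (hfin n) u)) p,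
    nerveMap_mem (hfin n) (href n) p.2⟩

end Nerves

/-! ## Word length and hyperbolicity -/

section WordLength

variable {G : Type*} [Group G] {Q : ℕ}

/-- The word length with respect to the generators `S 0, …, S (Q-1)`. -/
def len (S : Fin Q → G) (g : G) : ℕ :=
  sInf {n | ∃ l : List (Fin Q), l.length = n ∧ (l.map S).prod = g}

/-- The word metric. -/
def wdist (S : Fin Q → G) (x y : G) : ℕ := len S (x⁻¹ * y)

/-- `S` enumerates a finite generating set which is closed under taking inverses. -/
structure IsSymmetricGenerating (S : Fin Q → G) : Prop where
  inv_mem : ∀ i, ∃ j, S j = (S i)⁻¹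
  closure_eq_top : Subgroup.closure (Set.range S) = ⊤

/-- The Gromov product of `x` and `y` with respect to `w`. -/
def gromovProduct (S : Fin Q → G) (x y w : G) : ℝ :=
  ((wdist S x w : ℝ) + wdist S y w - wdist S x y) / 2

/-- `G` with the word metric is `δ`-hyperbolic in the sense of Gromov. -/
def IsHyperbolic (S : Fin Q → G) (δ : ℝ) : Prop :=
  ∀ x y z w : G,
    min (gromovProduct S x y w) (gromovProduct S y z w) - δ ≤ gromovProduct S x z w

theorem exists_word {S : Fin Q → G} (hS : IsSymmetricGenerating S) (g : G) :
    ∃ l : List (Fin Q), (l.map S).prod = g := by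
  have hg : g ∈ Subgroup.closure (Set.range S) := by rw [hS.closure_eq_top]; trivial
  induction hg using Subgroup.closure_induction with
  | mem x hx => obtain ⟨i, rfl⟩ := hx; exact ⟨[i], by simp⟩
  | one => exact ⟨[], by simp⟩
  | mul x y _ _ hx hy =>
    obtain ⟨l, rfl⟩ := hx
    obtain ⟨l', rfl⟩ := hy
    exact ⟨l ++ l', by simp⟩
  | inv x _ hx =>
    obtain ⟨l, rfl⟩ := hx
    choose j hj using hS.inv_mem
    refine ⟨(l.map j).reverse, ?_⟩
    rw [List.prod_inv_reverse, List.map_reverse, List.map_map, List.map_map]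
    congr 3
    funext i
    exact hj i

theorem sphere_finite {S : Fin Q → G} (hS : IsSymmetricGenerating S) (n : ℕ) :
    {g : G | len S g = n}.Finite := by
  refine ((List.finite_length_eq (Fin Q) n).image (fun l => (l.map S).prod)).subset ?_
  rintro g rfl
  exact Nat.sInf_mem (s := {n | ∃ l : List (Fin Q), l.length = n ∧ (l.map S).prod = g})
    (by obtain ⟨l, hl⟩ := exists_word hS g; exact ⟨_, l, rfl, hl⟩)

end WordLength

/-! ## Quasi-invariant systems of covers -/

section QuasiInvariant

variable {G : Type*} [Group G] {Q : ℕ} {X : Type*}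

/-- The family of the nonempty sets among the `U x` with `|x| = n`. -/
def level (S : Fin Q → G) (U : G → Set X) (n : ℕ) : Set (Set X) :=
  {u | u.Nonempty ∧ ∃ x, len S x = n ∧ U x = u}

/-- `U` is a quasi-`G`-invariant system with respect to the type function `T` (with values in a
finite set), with neighbourhood constant `D` and jump constant `J`. -/
structure IsQuasiInvariant [PseudoEMetricSpace X] [MulAction G X] (S : Fin Q → G) (U : G → Set X)
    {𝒯 : Type*} (T : G → 𝒯) (D : ℝ) (J : ℕ) : Prop where
  finite_types : Finite 𝒯
  D_pos : 0 < D
  J_pos : 0 < J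
  mesh : ∀ ε > 0, ∃ n₀, ∀ x, n₀ ≤ len S x → Metric.ediam (U x) ≤ ε
  near : ∀ x y, len S x = len S y → (U x ∩ U y).Nonempty → (wdist S x y : ℝ) ≤ D
  jump : ∀ x k, 0 < k → k * J ≤ len S x → ∃ y, len S y = len S x - k * J ∧ U x ⊆ U y
  smul_eq : ∀ g x, T x = T (g * x) → U (g * x) = g • U x
  smul_neighbour : ∀ g x, T x = T (g * x) → ∀ y, len S y = len S x → (U x ∩ U y).Nonempty →
    U (g * y) = g • U y ∧ len S (g * y) = len S (g * x)
  smul_child : ∀ g x, T x = T (g * x) → ∀ y k, 0 < k → len S y = len S x + k * J →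
    (U y).Nonempty → U y ⊆ U x →
    len S (g * y) = len S (g * x) + k * J ∧ T (g * y) = T y ∧ U (g * y) = g • U y

/-- `U` is a system of covers: for every `n`, the sets `U x` with `|x| = n` form an open cover. -/
def IsSystemOfCovers [TopologicalSpace X] (S : Fin Q → G) (U : G → Set X) : Prop :=
  ∀ n, (∀ x, len S x = n → IsOpen (U x)) ∧ ⋃ x ∈ {x | len S x = n}, U x = Set.univ

theorem level_finite {S : Fin Q → G} (hS : IsSymmetricGenerating S) (U : G → Set X) (n : ℕ) :
    (level S U n).Finite := by
  refine ((sphere_finite hS n).image U).subset ?_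
  rintro u ⟨_, x, hx, rfl⟩
  exact ⟨x, hx, rfl⟩

theorem level_refines [PseudoEMetricSpace X] [MulAction G X] {S : Fin Q → G} {U : G → Set X}
    {𝒯 : Type*} {T : G → 𝒯} {D : ℝ} {J : ℕ} (hU : IsQuasiInvariant S U T D J) {L : ℕ}
    (hL : 0 < L) (hJ : J ∣ L) (n : ℕ) :
    ∀ u ∈ level S U ((n + 1) * L), ∃ w ∈ level S U (n * L), u ⊆ w := by
  rintro u ⟨hne, x, hx, rfl⟩
  obtain ⟨k, rfl⟩ := hJ
  have hk : 0 < k := Nat.pos_of_mul_pos_left hL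
  obtain ⟨y, hy, hxy⟩ := hU.jump x k hk (by rw [hx]; nlinarith)
  refine ⟨U y, ⟨hne.mono hxy, y, ?_, rfl⟩, hxy⟩
  rw [hy, hx, add_mul, one_mul, mul_comm k J, Nat.add_sub_cancel]

/-- The inverse system of nerves of the covers `(U x)_{|x| = n L}` with empty members removed. -/
def coverNerveSystem [PseudoEMetricSpace X] [MulAction G X] {S : Fin Q → G}
    (hS : IsSymmetricGenerating S) {U : G → Set X} {𝒯 : Type*} {T : G → 𝒯} {D : ℝ} {J : ℕ}
    (hU : IsQuasiInvariant S U T D J) {L : ℕ} (hL : 0 < L) (hJ : J ∣ L) : PolyhedralSystem :=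
  nerveSystem (fun n => level S U (n * L)) (fun n => level_finite hS U (n * L))
    (level_refines hU hL hJ)

/-- The set of vertices of the labelled graph of a simplex `s` of the nerve at level `n`: all
elements of `G` of length `n` which represent a vertex of `s`. -/
def graphVertices (S : Fin Q → G) (U : G → Set X) (n : ℕ) (s : Finset (Set X)) : Set G :=
  {g | len S g = n ∧ U g ∈ s}

/-- Similarity of a simplex `s` at level `n` with a simplex `s'` at level `n'`, that is, equality of
their basic simplex types: an isomorphism between their labelled (complete) graphs, where a vertex
`g` is labelled with `T g` and an edge `(g, g')` with `g⁻¹ * g'`. -/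
def SimilarSimplexes (S : Fin Q → G) (U : G → Set X) {𝒯 : Type*} (T : G → 𝒯) (n n' : ℕ)
    (s s' : Finset (Set X)) : Prop :=
  ∃ φ : graphVertices S U n s ≃ graphVertices S U n' s',
    (∀ g, T (φ g) = T g) ∧
    ∀ g g', g ≠ g' → ((φ g : G))⁻¹ * (φ g' : G) = ((g : G))⁻¹ * (g' : G)

end QuasiInvariant

/-! ## The `B`-type -/

section BType

variable {G : Type*} [Group G] {Q : ℕ} (S : Fin Q → G) (δ : ℝ) (N L : ℕ)

/-- The ball `N`-type of `x`, a function on the ball of radius `N` around `1`. -/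
def ballType (x : G) : {y : G // len S y ≤ N} → ℤ :=
  fun y => (len S (x * y) : ℤ) - len S x

open Classical in
/-- The prioritised parent of `y`, namely `y * S i` with the least `i` for which this is a parent
of `y` (that is, has length `|y| - 1`). Junk value `y` for `y = 1`. -/
def pParent (y : G) : G :=
  if h : (Finset.univ.filter fun i => len S (y * S i) + 1 = len S y).Nonempty then
    y * S ((Finset.univ.filter fun i => len S (y * S i) + 1 = len S y).min' h)
  else y

/-- The prioritised ancestor of `y` which is `k` generations older, for `k ≤ |y|`. -/
def pAncestor (k : ℕ) (y : G) : G := (pParent S)^[k] y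

/-- The prioritised grandchildren of `g` (with `L` generations between). -/
def pGrandchildren (g : G) : Set G :=
  {x | len S x = len S g + L ∧ pAncestor S L x = g}

/-- The set of possible values of the `Z`-type. -/
abbrev ZType := ({y : G // len S y ≤ N} → ℤ) ⊕ G

/-- The `Z`-type: the ball `N`-type for elements of length at least `L`, and pairwise distinct new
values for the other elements. -/
def zType (g : G) : ZType S N :=
  if len S g < L then Sum.inr g else Sum.inl (ballType S N g)

/-- The auxiliary choices: a representative of every `Z`-type, and an enumeration of the
prioritised grandchildren of every representative. -/
structure TypeChoices where
  rep : ZType S N → G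
  num : ZType S N → G → ℕ
  zType_rep : ∀ g, zType S N L (rep (zType S N L g)) = zType S N L g
  num_bijOn : ∀ g, Set.BijOn (num (zType S N L g)) (pGrandchildren S L (rep (zType S N L g)))
    (Set.Icc 1 (pGrandchildren S L (rep (zType S N L g))).ncard)

variable {S N L} in
/-- The descendant number of `g`. -/
def descendantNumber (c : TypeChoices S N L) (g : G) : ℕ :=
  if len S g < L then 0 else
    let h := pAncestor S L g
    let τ := zType S N L h
    c.num τ (c.rep τ * h⁻¹ * g)

variable {S N L} in
/-- The `A`-type. -/
def aType (c : TypeChoices S N L) (g : G) : ZType S N × ℕ :=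
  (zType S N L g, descendantNumber c g)

/-- The constant `R`: the maximum of `16 δ` and of the lengths of all powers of torsion elements of
length at most `16 δ`. -/
def cousinRadius : ℝ :=
  sSup ({r : ℝ | ∃ g : G, (len S g : ℝ) ≤ 16 * δ ∧ IsOfFinOrder g ∧
    ∃ n : ℤ, r = (len S (g ^ n) : ℝ)} ∪ {16 * δ})

/-- The set of cousins of `g`. -/
def cousins (g : G) : Set G :=
  {g' | len S g' = len S g ∧ (wdist S g g' : ℝ) ≤ cousinRadius S δ}

variable {S N L} in
/-- The least `k` for which the `k`-th iterated prioritised grandparents of `g` and `g'` (two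
distinct elements of equal length) have different `A`-types. -/
def firstDifference (c : TypeChoices S N L) (g g' : G) : ℕ :=
  sInf {k | L * k ≤ len S g ∧ L * k ≤ len S g' ∧
    aType c (pAncestor S (L * k) g) ≠ aType c (pAncestor S (L * k) g')}

open Classical in
variable {S N L} in
/-- The numbers `firstDifference c g' g''` for distinct cousins `g'`, `g''` of `g`, together
with `0`, in decreasing order. (None of them exceeds `|g|`.) -/
def differenceSequence (c : TypeChoices S N L) (g : G) : List ℕ :=
  ((Finset.range (len S g + 1)).filter fun k => k = 0 ∨
    ∃ g' ∈ cousins S δ g, ∃ g'' ∈ cousins S δ g, g' ≠ g'' ∧ k = firstDifference c g' g'').sort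
    (· ≥ ·)

variable {S N L} in
/-- The `B`-type. -/
def bType (c : TypeChoices S N L) (g : G) : Set (G × List (ZType S N × ℕ)) :=
  {w | ∃ g' ∈ cousins S δ g, w =
    (g⁻¹ * g', (differenceSequence δ c g).map fun k => aType c (pAncestor S (L * k) g'))}

end BType

end

end MarkovNerve

open MarkovNerve

namespace MarkovNerve

/-! ### Word length, the word metric and prioritised ancestors. -/

section Length

variable {G : Type*} [Group G] {Q : ℕ} {S : Fin Q → G}

theorem len_le_of_word (l : List (Fin Q)) : len S (l.map S).prod ≤ l.length :=
  Nat.sInf_le ⟨l, rfl, rfl⟩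

theorem exists_word_len (hS : IsSymmetricGenerating S) (g : G) :
    ∃ l : List (Fin Q), l.length = len S g ∧ (l.map S).prod = g :=
  Nat.sInf_mem (s := {n | ∃ l : List (Fin Q), l.length = n ∧ (l.map S).prod = g})
    (by obtain ⟨l, hl⟩ := exists_word hS g; exact ⟨_, l, rfl, hl⟩)

@[simp] theorem len_one : len S (1 : G) = 0 := by
  simpa using len_le_of_word (S := S) []

theorem len_eq_zero (hS : IsSymmetricGenerating S) {g : G} : len S g = 0 ↔ g = 1 := by
  refine ⟨fun h => ?_, fun h => by simp [h]⟩
  obtain ⟨l, hl, rfl⟩ := exists_word_len hS g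
  rw [h, List.length_eq_zero_iff] at hl
  simp [hl]

theorem len_mul_le (hS : IsSymmetricGenerating S) (g h : G) :
    len S (g * h) ≤ len S g + len S h := by
  obtain ⟨l, hl, hg⟩ := exists_word_len hS g
  obtain ⟨l', hl', hh⟩ := exists_word_len hS h
  rw [← hl, ← hl', ← List.length_append]
  conv_lhs => rw [← hg, ← hh, ← List.prod_append, ← List.map_append]
  exact len_le_of_word _

theorem len_inv_le (hS : IsSymmetricGenerating S) (g : G) : len S g⁻¹ ≤ len S g := by
  obtain ⟨l, hl, hg⟩ := exists_word_len hS g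
  choose j hj using hS.inv_mem
  have : ((l.map j).reverse.map S).prod = g⁻¹ := by
    rw [← hg, List.prod_inv_reverse, List.map_reverse, List.map_map, List.map_map]
    congr 3
    funext i
    exact hj i
  rw [← this, ← hl]
  simpa using len_le_of_word (S := S) (l.map j).reverse

theorem len_inv (hS : IsSymmetricGenerating S) (g : G) : len S g⁻¹ = len S g :=
  le_antisymm (len_inv_le hS g) (by simpa using len_inv_le hS g⁻¹)

theorem len_gen_le (i : Fin Q) : len S (S i) ≤ 1 := by
  simpa using len_le_of_word (S := S) [i]

theorem len_pow_le (hS : IsSymmetricGenerating S) (g : G) (n : ℕ) :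
    len S (g ^ n) ≤ n * len S g := by
  induction n with
  | zero => simp
  | succ n ih =>
    rw [pow_succ, add_mul, one_mul]
    exact (len_mul_le hS _ _).trans (by omega)

theorem ball_finite (hS : IsSymmetricGenerating S) (r : ℝ) : {g : G | (len S g : ℝ) ≤ r}.Finite := by
  refine (Set.Finite.biUnion (Set.finite_Iic ⌊r⌋₊) fun n _ => sphere_finite hS n).subset ?_
  intro g hg
  exact Set.mem_biUnion (Nat.le_floor hg) rfl

theorem wdist_comm (hS : IsSymmetricGenerating S) (x y : G) : wdist S x y = wdist S y x := by
  rw [wdist, wdist, ← len_inv hS]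
  simp

@[simp] theorem wdist_mul_left (g x y : G) : wdist S (g * x) (g * y) = wdist S x y := by
  simp [wdist, mul_assoc]

theorem wdist_one_right (hS : IsSymmetricGenerating S) (x : G) : wdist S x 1 = len S x := by
  simp [wdist, len_inv hS]

theorem wdist_triangle (hS : IsSymmetricGenerating S) (x y z : G) :
    wdist S x z ≤ wdist S x y + wdist S y z := by
  have := len_mul_le hS (x⁻¹ * y) (y⁻¹ * z)
  simpa [wdist, mul_assoc] using this

/-- Every nontrivial element has a neighbour closer to the neutral element. -/
theorem exists_parent (hS : IsSymmetricGenerating S) {y : G} (hy : len S y ≠ 0) :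
    ∃ i, len S (y * S i) + 1 = len S y := by
  obtain ⟨l, hl, hp⟩ := exists_word_len hS y
  rcases List.eq_nil_or_concat l with rfl | ⟨l', a, rfl⟩
  · exact absurd hl.symm hy
  obtain ⟨j, hj⟩ := hS.inv_mem a
  have h1 : y * S j = (l'.map S).prod := by
    rw [← hp, hj]; simp
  have h2 := len_le_of_word (S := S) l'
  have h3 := len_mul_le hS (y * S j) (S a)
  have h4 := len_gen_le (S := S) a
  simp only [hj, inv_mul_cancel_right] at h3
  simp only [List.concat_eq_append, List.length_append, List.length_singleton] at hl
  refine ⟨j, ?_⟩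
  rw [hj] at h1 ⊢
  rw [h1] at h3 ⊢
  omega

theorem pParent_spec (hS : IsSymmetricGenerating S) {y : G} (hy : len S y ≠ 0) :
    len S (pParent S y) + 1 = len S y ∧ wdist S y (pParent S y) ≤ 1 := by
  classical
  have hne : (Finset.univ.filter fun i => len S (y * S i) + 1 = len S y).Nonempty := by
    obtain ⟨i, hi⟩ := exists_parent hS hy
    exact ⟨i, by simpa using hi⟩
  have hm := Finset.min'_mem _ hne
  rw [Finset.mem_filter] at hm
  have heq : pParent S y =
      y * S ((Finset.univ.filter fun i => len S (y * S i) + 1 = len S y).min' hne) := by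
    rw [pParent, dif_pos (by convert hne)]
  rw [heq]
  refine ⟨hm.2, ?_⟩
  simpa [wdist] using len_gen_le (S := S) _

theorem pAncestor_add (a b : ℕ) (y : G) :
    pAncestor S (a + b) y = pAncestor S a (pAncestor S b y) :=
  Function.iterate_add_apply _ _ _ _

@[simp] theorem pAncestor_zero (y : G) : pAncestor S 0 y = y := rfl

theorem pAncestor_spec (hS : IsSymmetricGenerating S) (y : G) (k : ℕ) (hk : k ≤ len S y) :
    len S (pAncestor S k y) + k = len S y ∧ wdist S y (pAncestor S k y) ≤ k := by
  induction k with
  | zero => simp [wdist]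
  | succ k ih =>
    obtain ⟨h1, h2⟩ := ih (by omega)
    have h3 := pParent_spec hS (y := pAncestor S k y) (by omega)
    rw [add_comm k 1, pAncestor_add]
    change len S (pParent S _) + _ = _ ∧ wdist S _ (pParent S _) ≤ _
    refine ⟨by omega, (wdist_triangle hS _ (pAncestor S k y) _).trans (by omega)⟩

theorem len_pAncestor (hS : IsSymmetricGenerating S) {y : G} {k : ℕ} (hk : k ≤ len S y) :
    len S (pAncestor S k y) = len S y - k := by
  have := (pAncestor_spec hS y k hk).1
  omega

end Length

/-! ### Hyperbolicity: an element with many powers moving a point along its sphere is torsion. -/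

section Hyperbolic

variable {G : Type*} [Group G] {Q : ℕ} {S : Fin Q → G} {δ : ℝ}

/-- The four point condition. -/
theorem IsHyperbolic.four_point (hG : IsHyperbolic S δ) (x y z w : G) :
    (wdist S x z : ℝ) + wdist S y w ≤
      max ((wdist S x y : ℝ) + wdist S z w) (wdist S y z + wdist S x w) + 2 * δ := by
  have h := hG x y z w
  simp only [gromovProduct] at h
  rcases min_cases (((wdist S x w : ℝ) + wdist S y w - wdist S x y) / 2)
    (((wdist S y w : ℝ) + wdist S z w - wdist S y z) / 2) with ⟨h1, _⟩ | ⟨h1, _⟩ <;>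
    rw [h1] at h
  · have := le_max_left ((wdist S x y : ℝ) + wdist S z w) (wdist S y z + wdist S x w)
    linarith
  · have := le_max_right ((wdist S x y : ℝ) + wdist S z w) (wdist S y z + wdist S x w)
    linarith

/-- If sufficiently many powers of `t` move `x` along a sphere around the neutral element, then
one of them is trivial. -/
theorem exists_pow_eq_one_of_len_mul_pow (hS : IsSymmetricGenerating S) (hG : IsHyperbolic S δ)
    {K : ℕ} (hK : {g : G | (len S g : ℝ) ≤ 6 * δ + 1}.ncard ≤ K) {x t : G}
    (hx : ∀ i : ℤ, |i| ≤ K → len S (x * t ^ i) = len S x) :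
    ∃ j : ℕ, 0 < j ∧ j ≤ K ∧ t ^ j = 1 := by
  classical
  have hδ : 0 ≤ δ := by
    have := hG 1 1 1 1
    simp [gromovProduct, wdist] at this
    linarith
  obtain ⟨m, hm, hmax⟩ := Finset.exists_max_image (Finset.range (K + 1)) (fun i => len S (t ^ i))
    ⟨0, by simp⟩
  simp only [Finset.mem_range, Nat.lt_succ_iff] at hm hmax
  -- Half of the largest displacement, rounded up. The ancestor of x at distance h will be an
  -- approximate centre of the points x t^i.
  set h := (len S (t ^ m) + 1) / 2 with hh
  have hpow : ∀ i : ℤ, |i| ≤ K → len S (t ^ i) ≤ 2 * h := by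
    intro i hi
    have h1 : len S (t ^ i.natAbs) ≤ len S (t ^ m) := hmax _ (by rw [Int.abs_eq_natAbs] at hi; omega)
    have h2 : len S (t ^ i) = len S (t ^ i.natAbs) := by
      rcases Int.natAbs_eq i with h | h
      · conv_lhs => rw [h, zpow_natCast]
      · conv_lhs => rw [h, zpow_neg, zpow_natCast, len_inv hS]
    omega
  have hmx : len S (x * t ^ m) = len S x := by
    simpa using hx m (by simpa using hm)
  have hhx : h ≤ len S x := by
    have h1 := len_mul_le hS x⁻¹ (x * t ^ m)
    rw [inv_mul_cancel_left, len_inv hS, hmx] at h1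
    omega
  set q := pAncestor S h x with hq
  obtain ⟨hq1, hq2⟩ := pAncestor_spec hS x h hhx
  rw [← hq] at hq1 hq2
  have hclose : ∀ i : ℤ, |i| ≤ K → (wdist S (x * t ^ i) q : ℝ) ≤ h + 2 * δ := by
    intro i hi
    have h4 := hG.four_point (x * t ^ i) x q 1
    rw [wdist_one_right hS, wdist_one_right hS, wdist_one_right hS, hx i hi] at h4
    have h5 : wdist S (x * t ^ i) x ≤ 2 * h := by
      rw [wdist_comm hS]
      simpa [wdist] using hpow i hi
    have h6 : (wdist S (x * t ^ i) x : ℝ) ≤ 2 * h := by exact_mod_cast h5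
    have h7 : (len S q : ℝ) + h = len S x := by exact_mod_cast hq1
    have h8 : (wdist S x q : ℝ) ≤ h := by exact_mod_cast hq2
    have h9 := max_le (a := (wdist S (x * t ^ i) x : ℝ) + len S q)
      (b := (wdist S x q : ℝ) + len S x) (c := h + len S x) (by linarith) (by linarith)
    linarith
  -- The isometry x t^j x⁻¹ shifts the exponents of the orbit, so it takes q to a point that is
  -- again within h + 2δ of every x t^i with 0 ≤ i ≤ K. Thus q and its image are both approximate
  -- midpoints of x and x t^m, which are at least 2h - 1 apart, and the four point condition bounds
  -- their distance by 6δ + 1.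
  have hball : ∀ j : ℕ, j ≤ K →
      (len S (q⁻¹ * (x * t ^ j * x⁻¹ * q)) : ℝ) ≤ 6 * δ + 1 := by
    intro j hj
    have h1 : ∀ i : ℕ, i ≤ K → (wdist S (x * t ^ i) (x * t ^ j * x⁻¹ * q) : ℝ) ≤ h + 2 * δ := by
      intro i hi
      have h2 := hclose ((i : ℤ) - j) (by rw [abs_le]; omega)
      rw [← wdist_mul_left (x * t ^ j * x⁻¹)] at h2
      convert h2 using 3
      rw [zpow_sub, zpow_natCast, zpow_natCast]
      have : t ^ i * (t ^ j)⁻¹ = (t ^ j)⁻¹ * t ^ i :=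
        ((Commute.refl t).pow_pow i j).inv_right.eq
      rw [this]
      group
    have h2 := hG.four_point x q (x * t ^ m) (x * t ^ j * x⁻¹ * q)
    have h3 := h1 0 (Nat.zero_le _)
    have h4 := h1 m hm
    have h5 := hclose 0 (by simp)
    have h6 := hclose m (by simpa using hm)
    simp only [pow_zero, zpow_zero, mul_one, zpow_natCast] at h3 h5 h6
    have h7 : wdist S x (x * t ^ m) + 1 ≥ 2 * h := by
      simp only [wdist, inv_mul_cancel_left]
      omega
    have h8 : (wdist S x (x * t ^ m) : ℝ) + 1 ≥ 2 * h := by exact_mod_cast h7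
    rw [wdist_comm hS q (x * t ^ m)] at h2
    have h9 := max_le (a := (wdist S x q : ℝ) + wdist S (x * t ^ m) (x * t ^ j * x⁻¹ * q))
      (b := (wdist S (x * t ^ m) q : ℝ) + wdist S x (x * t ^ j * x⁻¹ * q))
      (c := 2 * h + 4 * δ) (by linarith) (by linarith)
    change (wdist S q (x * t ^ j * x⁻¹ * q) : ℝ) ≤ _
    linarith
  have hfin := ball_finite hS (6 * δ + 1)
  -- There are K + 1 exponents but at most K elements in the ball, and the displacement of q
  -- determines t^j.
  obtain ⟨i, hi, j, hj, hij, he⟩ := Finset.exists_ne_map_eq_of_card_lt_of_maps_to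
    (s := Finset.range (K + 1)) (t := hfin.toFinset)
    (f := fun j => q⁻¹ * (x * t ^ j * x⁻¹ * q))
    (by rw [← Set.ncard_eq_toFinset_card _ hfin, Finset.card_range]; omega)
    (fun j hj => by
      simp only [Finset.coe_range, Set.mem_Iio] at hj
      simpa using hball j (by omega))
  simp only [Finset.mem_range] at hi hj
  have he' : t ^ i = t ^ j := by simpa using he
  rcases Nat.lt_or_gt_of_ne hij with h | h
  · exact ⟨j - i, by omega, by omega, by rw [pow_sub _ h.le, he', mul_inv_cancel]⟩
  · exact ⟨i - j, by omega, by omega, by rw [pow_sub _ h.le, he', mul_inv_cancel]⟩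

end Hyperbolic

/-! ### Cones: the ball type controls lengths and p-grandchildren at any distance. -/

section Cones

variable {G : Type*} [Group G] {Q : ℕ} {S : Fin Q → G} {δ : ℝ} {N M : ℕ}

theorem len_mul_eq_of_ballType (x y : G) (h : ballType S N x = ballType S N y) {z : G}
    (hz : len S z ≤ N) : len S (x * z) + len S y = len S (y * z) + len S x := by
  have := congrFun h ⟨z, hz⟩
  simp only [ballType] at this
  omega

/-- A one-sided comparison of lengths near the cones of elements of equal ball type. -/
theorem len_mul_le_of_ballType (hS : IsSymmetricGenerating S) (hG : IsHyperbolic S δ)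
    (hN : 2 + 2 * δ ≤ N) {x y : G} (h : ballType S N x = ballType S N y) {z w : G}
    (hz : len S (x * z) = len S x + len S z) (hw : len S w ≤ 1) :
    len S (y * (z * w)) + len S x ≤ len S (x * (z * w)) + len S y := by
  have hδ : 0 ≤ δ := by
    have := hG 1 1 1 1
    simp [gromovProduct, wdist] at this
    linarith
  have hN2 : 2 ≤ N := by
    have : (2 : ℝ) ≤ N := by linarith
    exact_mod_cast this
  have hzw := len_mul_le hS z w
  have hxzw := len_mul_le hS (x * (z * w)) w⁻¹
  rw [len_inv hS, mul_assoc, mul_assoc, mul_inv_cancel, mul_one, hz] at hxzw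
  rcases Nat.eq_zero_or_pos (len S z) with h0 | h0
  · exact (len_mul_eq_of_ballType x y h (by omega)).ge
  -- The ancestor p of u = xzw on the sphere of x is, by the four point condition, within 2 + 2δ ≤ N
  -- of x. Hence the ball type gives |y x⁻¹ p| = |y|, and a geodesic from p to u, translated by y
  -- x⁻¹, bounds |yzw|.
  have hk : len S (x * (z * w)) - len S x ≤ len S (x * (z * w)) := Nat.sub_le _ _
  set u := x * (z * w) with hu
  obtain ⟨hp1, hp2⟩ := pAncestor_spec hS u _ hk
  set p := pAncestor S (len S u - len S x) u with hp
  have h4 := hG.four_point p u x 1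
  rw [wdist_one_right hS, wdist_one_right hS, wdist_one_right hS, wdist_comm hS p u] at h4
  have h5 : wdist S u x ≤ len S u - len S x + 2 := by
    have h6 : wdist S x u = len S (z * w) := by rw [hu, wdist, inv_mul_cancel_left]
    rw [wdist_comm hS, h6]
    omega
  have h6 : len S p = len S x := by omega
  have h7 : wdist S p x ≤ N := by
    have e1 : (wdist S u x : ℝ) + len S x ≤ len S u + 2 := by
      have : wdist S u x + len S x ≤ len S u + 2 := by omega
      exact_mod_cast this
    have e2 : (wdist S u p : ℝ) + len S x ≤ len S u := by
      have : wdist S u p + len S x ≤ len S u := by omega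
      exact_mod_cast this
    have e3 : (len S p : ℝ) = len S x := by rw [h6]
    have e4 := max_le (a := (wdist S u p : ℝ) + len S x) (b := (wdist S u x : ℝ) + len S p)
      (c := len S u + 2) (by linarith) (by linarith)
    have e5 : (wdist S p x : ℝ) ≤ N := by linarith
    exact_mod_cast e5
  have h8 := len_mul_eq_of_ballType x y h (z := x⁻¹ * p) (by rwa [wdist_comm hS] at h7)
  rw [mul_inv_cancel_left] at h8
  have h9 := len_mul_le hS (y * (x⁻¹ * p)) (p⁻¹ * u)
  have h10 : y * (x⁻¹ * p) * (p⁻¹ * u) = y * (z * w) := by rw [hu]; group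
  rw [h10] at h9
  have h11 : wdist S p u ≤ len S u - len S x := by rwa [wdist_comm hS]
  rw [wdist] at h11
  omega

theorem exists_prefix (hS : IsSymmetricGenerating S) {z : G} (hz : len S z ≠ 0) :
    ∃ z' w, z = z' * w ∧ len S z' + 1 = len S z ∧ len S w ≤ 1 := by
  obtain ⟨i, hi⟩ := exists_parent hS hz
  exact ⟨z * S i, (S i)⁻¹, by simp, hi, by rw [len_inv hS]; exact len_gen_le i⟩

/-- Elements of equal ball type have equal cones. -/
theorem cone_of_ballType (hS : IsSymmetricGenerating S) (hG : IsHyperbolic S δ)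
    (hN : 2 + 2 * δ ≤ N) {x y : G} (h : ballType S N x = ballType S N y) (n : ℕ) :
    ∀ z : G, len S z = n → len S (x * z) = len S x + len S z →
      len S (y * z) = len S y + len S z := by
  induction n with
  | zero => intro z hz _; rw [len_eq_zero hS] at hz; simp [hz]
  | succ n ih =>
    intro z hz hxz
    obtain ⟨z', w, rfl, h1, h2⟩ := exists_prefix hS (z := z) (by omega)
    have h3 : len S (x * z') = len S x + len S z' := by
      have h4 := len_mul_le hS x z'
      have h5 := len_mul_le hS (x * z') w
      rw [mul_assoc] at h5
      omega
    have h6 := len_mul_le_of_ballType hS hG hN h.symm (ih z' (by omega) h3) h2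
    have h7 := len_mul_le hS y (z' * w)
    omega

/-- By `cone_of_ballType` the element z lies in the cone of y as well, so the one-sided estimate
applies in both directions. -/
theorem len_mul_eq_of_cone (hS : IsSymmetricGenerating S) (hG : IsHyperbolic S δ)
    (hN : 2 + 2 * δ ≤ N) {x y : G} (h : ballType S N x = ballType S N y) {z w : G}
    (hz : len S (x * z) = len S x + len S z) (hw : len S w ≤ 1) :
    len S (y * (z * w)) + len S x = len S (x * (z * w)) + len S y :=
  le_antisymm (len_mul_le_of_ballType hS hG hN h hz hw)
    (len_mul_le_of_ballType hS hG hN h.symm (cone_of_ballType hS hG hN h _ z rfl hz) hw)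

/-- The choice of the p-parent depends only on the set of generators that shorten the element. -/
theorem pParent_mul_left (g y : G)
    (h : ∀ i, len S (g * y * S i) + 1 = len S (g * y) ↔ len S (y * S i) + 1 = len S y) :
    pParent S (g * y) = g * pParent S y := by
  classical
  unfold pParent
  simp only [h]
  split_ifs <;> simp [mul_assoc]

/-- The p-ancestors of g down to x lie on a geodesic from x to g, hence x⁻¹ times each of them lies
in the cone of x. There the ball type decides which generators shorten, so every p-parent step
commutes with left multiplication by y x⁻¹. -/
theorem pGrandchildren_translate (hS : IsSymmetricGenerating S) (hG : IsHyperbolic S δ)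
    (hN : 2 + 2 * δ ≤ N) {x y : G} (h : ballType S N x = ballType S N y) {g : G}
    (hg : g ∈ pGrandchildren S M x) : y * x⁻¹ * g ∈ pGrandchildren S M y := by
  obtain ⟨hg1, hg2⟩ := hg
  have hcone : ∀ k ≤ M, len S (x * (x⁻¹ * pAncestor S k g)) =
      len S x + len S (x⁻¹ * pAncestor S k g) := by
    intro k hk
    rw [mul_inv_cancel_left, len_pAncestor hS (by omega), hg1]
    have h1 := pAncestor_spec hS (pAncestor S k g) (M - k)
      (by rw [len_pAncestor hS (by omega)]; omega)
    rw [← pAncestor_add, Nat.sub_add_cancel hk, hg2, len_pAncestor hS (by omega), wdist_comm hS,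
      wdist] at h1
    have h2 := len_mul_le hS x (x⁻¹ * pAncestor S k g)
    rw [mul_inv_cancel_left, len_pAncestor hS (by omega)] at h2
    omega
  have hanc : ∀ k ≤ M, pAncestor S k (y * x⁻¹ * g) = y * x⁻¹ * pAncestor S k g := by
    intro k
    induction k with
    | zero => simp
    | succ k ih =>
      intro hk
      rw [add_comm k 1, pAncestor_add, pAncestor_add, ih (by omega)]
      refine pParent_mul_left _ _ fun i => ?_
      have h1 := len_mul_eq_of_cone hS hG hN h (hcone k (by omega)) (len_gen_le (S := S) i)
      -- The choice w = 1 compares the two ancestors themselves, as `h1` compares their neighbours.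
      have h2 := len_mul_eq_of_cone hS hG hN h (hcone k (by omega)) (w := 1) (by simp)
      simp only [mul_one, ← mul_assoc, mul_inv_cancel, one_mul] at h1 h2 ⊢
      omega
  refine ⟨?_, ?_⟩
  · have h1 := cone_of_ballType hS hG hN h _ _ rfl (hcone 0 (by omega))
    have h2 := hcone 0 (by omega)
    simp only [pAncestor_zero, ← mul_assoc, mul_inv_cancel, one_mul] at h1 h2
    omega
  · rw [hanc M le_rfl, hg2]
    simp

end Cones

/-! ### Rigidity: close elements of equal length and B-type coincide. -/

section Rigidity

variable {G : Type*} [Group G] {Q : ℕ} {S : Fin Q → G} {δ : ℝ} {N M : ℕ}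

theorem zType_eq_cases {x y : G} (h : zType S N M x = zType S N M y) :
    x = y ∨ (M ≤ len S x ∧ ballType S N x = ballType S N y) := by
  unfold zType at h
  split_ifs at h with h1 h2
  · exact Or.inl (Sum.inr.inj h)
  · exact Or.inr ⟨by omega, Sum.inl.inj h⟩

/-- This makes the descendant number meaningful: the translate that is looked up does belong to the
enumerated set. -/
theorem grandchild_rep (hS : IsSymmetricGenerating S) (hG : IsHyperbolic S δ)
    (hN : 2 + 2 * δ ≤ N) (c : TypeChoices S N M) {h g : G} (hg : g ∈ pGrandchildren S M h) :
    c.rep (zType S N M h) * h⁻¹ * g ∈ pGrandchildren S M (c.rep (zType S N M h)) := by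
  rcases zType_eq_cases (c.zType_rep h) with h1 | ⟨_, h1⟩
  · rw [h1]; simpa using hg
  · exact pGrandchildren_translate hS hG hN h1.symm hg

/-- An element is determined by the `A`-types of its iterated grandparents. -/
theorem eq_of_aType_eq (hS : IsSymmetricGenerating S) (hG : IsHyperbolic S δ)
    (hN : 2 + 2 * δ ≤ N) (hM : 0 < M) (c : TypeChoices S N M) (n : ℕ) :
    ∀ g g' : G, len S g = n → len S g' = n →
      (∀ k, M * k ≤ n → aType c (pAncestor S (M * k) g) = aType c (pAncestor S (M * k) g')) →
      g = g' := by
  induction n using Nat.strong_induction_on with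
  | _ n ih =>
    intro g g' hg hg' h
    have h0 := h 0 (by simp)
    simp only [mul_zero, pAncestor_zero, aType, Prod.mk.injEq] at h0
    obtain ⟨hz, hd⟩ := h0
    by_cases hn : n < M
    · rcases zType_eq_cases hz with h1 | ⟨h1, _⟩
      · exact h1
      · omega
    -- The grandparents have the same histories, shifted by one generation, and so coincide by
    -- induction. The descendant number then singles out one p-grandchild of this common element.
    have hp : pAncestor S M g = pAncestor S M g' := by
      refine ih (n - M) (by omega) _ _ (by rw [len_pAncestor hS (by omega), hg])
        (by rw [len_pAncestor hS (by omega), hg']) fun k hk => ?_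
      rw [← pAncestor_add, ← pAncestor_add]
      have := h (k + 1) (by rw [mul_add]; omega)
      rwa [mul_add, mul_one] at this
    simp only [descendantNumber, hg, hg', hn, if_false, ← hp] at hd
    have hgc : g ∈ pGrandchildren S M (pAncestor S M g) :=
      ⟨by rw [len_pAncestor hS (by omega)]; omega, rfl⟩
    have hgc' : g' ∈ pGrandchildren S M (pAncestor S M g) :=
      ⟨by rw [len_pAncestor hS (by omega)]; omega, hp.symm⟩
    have := (c.num_bijOn (pAncestor S M g)).injOn (grandchild_rep hS hG hN c hgc)
      (grandchild_rep hS hG hN c hgc') hd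
    exact mul_left_cancel this

/-- A ball contains finitely many torsion elements, each with finitely many powers. Boundedness is
what makes the real `sSup` in `cousinRadius` an upper bound rather than a default value. -/
theorem cousinRadius_bddAbove (hS : IsSymmetricGenerating S) :
    BddAbove ({r : ℝ | ∃ g : G, (len S g : ℝ) ≤ 16 * δ ∧ IsOfFinOrder g ∧
      ∃ n : ℤ, r = (len S (g ^ n) : ℝ)} ∪ {16 * δ}) := by
  refine Set.Finite.bddAbove (Set.Finite.union ?_ (Set.finite_singleton _))
  refine (Set.Finite.biUnion
    (s := {g : G | (len S g : ℝ) ≤ 16 * δ ∧ IsOfFinOrder g})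
    (t := fun g => (fun y => (len S y : ℝ)) '' (Subgroup.zpowers g : Set G))
    ((ball_finite hS (16 * δ)).subset fun g hg => hg.1) fun g hg => ?_).subset ?_
  · exact (finite_zpowers.2 hg.2).image _
  · rintro r ⟨g, hg, hgf, n, rfl⟩
    exact Set.mem_biUnion (x := g) ⟨hg, hgf⟩ ⟨g ^ n, ⟨n, rfl⟩, rfl⟩

theorem len_zpow_le_cousinRadius (hS : IsSymmetricGenerating S) {t : G}
    (ht : (len S t : ℝ) ≤ 16 * δ) (hfin : IsOfFinOrder t) (n : ℤ) :
    (len S (t ^ n) : ℝ) ≤ cousinRadius S δ :=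
  le_csSup (cousinRadius_bddAbove hS) (Or.inl ⟨t, ht, hfin, n, rfl⟩)

theorem differenceSequence_sorted (c : TypeChoices S N M) (g : G) :
    (differenceSequence δ c g).SortedGT := by
  classical
  exact Finset.sortedGT_sort _

theorem mem_differenceSequence (c : TypeChoices S N M) {g : G} {k : ℕ} :
    k ∈ differenceSequence δ c g ↔ k ≤ len S g ∧ (k = 0 ∨
      ∃ g' ∈ cousins S δ g, ∃ g'' ∈ cousins S δ g, g' ≠ g'' ∧ k = firstDifference c g' g'') := by
  classical
  simp [differenceSequence]

/-- The first component of a member of `bType` identifies the cousin it comes from, so equality of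
the two sets can be read cousin by cousin. -/
theorem bType_transfer {c : TypeChoices S N M} {x y : G} (h : bType δ c x = bType δ c y) {z : G}
    (hz : x * z ∈ cousins S δ x) : y * z ∈ cousins S δ y ∧
      (differenceSequence δ c x).map (fun k => aType c (pAncestor S (M * k) (x * z))) =
      (differenceSequence δ c y).map (fun k => aType c (pAncestor S (M * k) (y * z))) := by
  have : (z, (differenceSequence δ c x).map
      fun k => aType c (pAncestor S (M * k) (x * z))) ∈ bType δ c y := by
    rw [← h]; exact ⟨x * z, hz, by simp⟩
  obtain ⟨g', hg', he⟩ := this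
  rw [Prod.mk.injEq] at he
  obtain ⟨rfl, he⟩ := he
  rw [mul_inv_cancel_left]
  exact ⟨hg', by simpa using he⟩

/-- Two decreasing lists contain the least exception to a predicate at the same position. -/
theorem exists_common_position {l l' : List ℕ} (hl : l.SortedGT) (hl' : l'.SortedGT)
    (hlen : l.length = l'.length) {P : ℕ → Prop} {κ : ℕ} (hκ : κ ∈ l) (hκ' : κ ∈ l')
    (hP : ∀ m (h : m < l.length) (h' : m < l'.length), P l[m] ↔ P l'[m]) (hn : ¬ P κ)
    (hlt : ∀ k < κ, P k) : ∃ m, ∃ (h : m < l.length) (h' : m < l'.length), l[m] = κ ∧ l'[m] = κ := by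
  obtain ⟨m, hm, rfl⟩ := List.mem_iff_getElem.1 hκ
  obtain ⟨m', hm', he⟩ := List.mem_iff_getElem.1 hκ'
  refine ⟨m, hm, hlen ▸ hm, rfl, ?_⟩
  -- The predicate fails at κ, hence also at the entry of the other list in the same position; since
  -- it holds below κ, that entry is at least κ. Used for both lists, together with their
  -- monotonicity, this leaves only equality.
  have h1 : l[m] ≤ l'[m]'(hlen ▸ hm) := by
    by_contra hc
    exact hn ((hP m hm _).2 (hlt _ (by omega)))
  have h2 : l[m] ≤ l[m']'(hlen ▸ hm') := by
    by_contra hc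
    exact hn (he ▸ (hP m' _ hm').1 (hlt _ (by omega)))
  have h3 : m' ≤ m := by
    by_contra hc
    have := hl.getElem_gt_getElem_of_lt (hi := hlen ▸ hm') (hj := hm) (by omega : m < m')
    omega
  have h4 : l'[m]'(hlen ▸ hm) ≤ l'[m'] := by
    rcases h3.eq_or_lt with h | h
    · simp [h]
    · exact (hl'.getElem_gt_getElem_of_lt (hi := hlen ▸ hm) (hj := hm') h).le
  omega

/-- Nearby elements of equal length and `B`-type coincide. -/
theorem eq_one_of_bType_eq (hS : IsSymmetricGenerating S) (hG : IsHyperbolic S δ)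
    (hN : 2 + 2 * δ ≤ N) {K : ℕ} (hK : {g : G | (len S g : ℝ) ≤ 6 * δ + 1}.ncard ≤ K)
    (hKN : 16 * δ * K ≤ N) (hM : 0 < M) (c : TypeChoices S N M) {x t : G}
    (hlen : len S (x * t) = len S x) (ht : (len S t : ℝ) ≤ 16 * δ)
    (hB : bType δ c x = bType δ c (x * t)) : t = 1 := by
  have hδ : 0 ≤ δ := by
    have := hG 1 1 1 1
    simp [gromovProduct, wdist] at this
    linarith
  have h16 : 16 * δ ≤ cousinRadius S δ := le_csSup (cousinRadius_bddAbove hS) (Or.inr rfl)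
  have hR0 : (0 : ℝ) ≤ cousinRadius S δ := by linarith
  have hx1 : x * 1 ∈ cousins S δ x := ⟨by simp, by simpa [wdist] using hR0⟩
  have hlength := congrArg List.length (bType_transfer hB hx1).2
  rw [List.length_map, List.length_map] at hlength
  -- a transferred equality of `A`-types at a common position
  have hA : ∀ z, x * z ∈ cousins S δ x → ∀ m (h : m < (differenceSequence δ c x).length)
      (h' : m < (differenceSequence δ c (x * t)).length),
      aType c (pAncestor S (M * (differenceSequence δ c x)[m]) (x * z)) =
      aType c (pAncestor S (M * (differenceSequence δ c (x * t))[m]) (x * t * z)) := by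
    intro z hz m h h'
    have := List.getElem_of_eq (bType_transfer hB hz).2 (i := m) (by simpa using h)
    simpa using this
  -- For the predicate that always fails the least exception is 0. So 0 has the same position in
  -- both sequences, and x and xt themselves have equal A-types.
  obtain ⟨m₀, h0, h0', e0, e0'⟩ := exists_common_position (κ := 0) (P := fun _ => False)
    (differenceSequence_sorted c x) (differenceSequence_sorted c (x * t)) hlength
    ((mem_differenceSequence c).2 (by simp)) ((mem_differenceSequence c).2 (by simp))
    (by simp) (by simp) (by simp)
  have hA0 := hA 1 hx1 m₀ h0 h0'
  simp only [e0, e0', mul_zero, pAncestor_zero, mul_one, aType, Prod.mk.injEq] at hA0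
  rcases zType_eq_cases hA0.1 with h1 | ⟨_, hball⟩
  · simpa using h1
  -- `t` is a torsion element
  have hpow : ∀ i : ℕ, i ≤ K → len S (t ^ i) ≤ N := by
    intro i hi
    have h1 : (len S (t ^ i) : ℝ) ≤ i * len S t := by exact_mod_cast len_pow_le hS t i
    have h2 : (i : ℝ) * len S t ≤ K * (16 * δ) := by
      have : (i : ℝ) ≤ K := by exact_mod_cast hi
      gcongr
    have : (len S (t ^ i) : ℝ) ≤ N := by linarith
    exact_mod_cast this
  have hstep : ∀ z : G, len S z ≤ N → len S (x * t * z) = len S (x * z) := by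
    intro z hz
    have := len_mul_eq_of_ballType _ _ hball hz
    omega
  have hpos : ∀ i : ℕ, i ≤ K → len S (x * t ^ i) = len S x := by
    intro i
    induction i with
    | zero => simp
    | succ i ih =>
      intro hi
      rw [pow_succ', ← mul_assoc, hstep _ (hpow i (by omega)), ih (by omega)]
  have hneg : ∀ i : ℕ, i ≤ K → len S (x * (t ^ i)⁻¹) = len S x := by
    intro i
    induction i with
    | zero => simp
    | succ i ih =>
      intro hi
      rw [← hstep _ (by rw [len_inv hS]; exact hpow _ hi), pow_succ, mul_inv_rev, mul_assoc,
        mul_inv_cancel_left, ih (by omega)]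
  obtain ⟨j, hj0, _, hj⟩ := exists_pow_eq_one_of_len_mul_pow hS hG hK (x := x) (t := t) (by
    intro i hi
    rcases Int.natAbs_eq i with h | h <;> rw [Int.abs_eq_natAbs] at hi
    · rw [h, zpow_natCast]; exact hpos _ (by omega)
    · rw [h, zpow_neg, zpow_natCast]; exact hneg _ (by omega))
  have htor : IsOfFinOrder t := isOfFinOrder_iff_pow_eq_one.2 ⟨j, hj0, hj⟩
  have hR := len_zpow_le_cousinRadius hS ht htor
  -- If x t^n is a cousin of x, then x t · t^n is a cousin of x t by equality of B-types, and so
  -- lies on the sphere of x. Its distance to x is the length of a power of t, which `cousinRadius`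
  -- bounds.
  have hsph : ∀ n : ℕ, x * t ^ n ∈ cousins S δ x := by
    intro n
    induction n with
    | zero => simpa using hx1
    | succ n ih =>
      obtain ⟨h1, _⟩ := (bType_transfer hB ih).1
      rw [mul_assoc, ← pow_succ', hlen] at h1
      exact ⟨h1, by
        rw [wdist, inv_mul_cancel_left, ← zpow_natCast]; exact hR _⟩
  have hz : ∀ n : ℤ, len S (x * t ^ n) = len S x := by
    intro n
    obtain ⟨k, hk⟩ := htor.mem_powers_iff_mem_zpowers.2 ⟨n, rfl⟩
    simp only at hk
    rw [← hk]
    exact (hsph k).1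
  have hcous : ∀ n : ℤ, x * t ^ n ∈ cousins S δ x := fun n =>
    ⟨hz n, by simpa [wdist] using hR n⟩
  have hcous' : ∀ n : ℤ, x * t ^ n ∈ cousins S δ (x * t) := fun n => by
    refine ⟨by rw [hz, hlen], ?_⟩
    have : wdist S (x * t) (x * t ^ n) = len S (t ^ (n - 1)) := by
      rw [wdist, zpow_sub_one]
      congr 1
      have : t ^ n * t⁻¹ = t⁻¹ * t ^ n := by
        rw [← zpow_sub_one, ← zpow_neg_one, ← zpow_add]; congr 1; ring
      rw [this]; group
    rw [this]
    exact hR _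
  by_contra htne
  -- the first generation in which the orbit of `x` is not constant
  let P : ℕ → Prop := fun k => ∀ i j : ℤ,
    aType c (pAncestor S (M * k) (x * t ^ i)) = aType c (pAncestor S (M * k) (x * t ^ j))
  -- Otherwise x and xt would have the same history of A-types and would coincide.
  have hex : ∃ k, M * k ≤ len S x ∧ ¬ P k := by
    by_contra! hcon
    refine htne ?_
    have := eq_of_aType_eq hS hG hN hM c _ x (x * t) rfl hlen fun k hk => by
      simpa using hcon k hk 0 1
    simpa using this
  classical
  obtain ⟨hκx, hκP⟩ := Nat.find_spec hex
  have hκlt : ∀ k < Nat.find hex, P k := by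
    intro k hk
    by_contra hc
    have hle : M * k ≤ len S x := (Nat.mul_le_mul_left M hk.le).trans hκx
    exact Nat.find_min hex hk ⟨hle, hc⟩
  set κ := Nat.find hex
  have hκle : κ ≤ len S x := (Nat.le_mul_of_pos_left κ hM).trans hκx
  obtain ⟨i, j, hij⟩ : ∃ i j : ℤ, aType c (pAncestor S (M * κ) (x * t ^ i)) ≠
      aType c (pAncestor S (M * κ) (x * t ^ j)) := by
    simpa [P] using hκP
  have hne : x * t ^ i ≠ x * t ^ j := fun h => hij (by rw [h])
  -- All earlier generations are constant on the orbit, so κ is the first difference of this pair.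
  -- As both points are cousins of x and of xt, κ occurs in both difference sequences.
  have hfd : κ = firstDifference c (x * t ^ i) (x * t ^ j) := by
    have hmem : κ ∈ {k | M * k ≤ len S (x * t ^ i) ∧ M * k ≤ len S (x * t ^ j) ∧
        aType c (pAncestor S (M * k) (x * t ^ i)) ≠ aType c (pAncestor S (M * k) (x * t ^ j))} :=
      ⟨by rwa [hz], by rwa [hz], hij⟩
    refine le_antisymm ?_ (Nat.sInf_le hmem)
    by_contra hc
    exact (Nat.sInf_mem ⟨κ, hmem⟩).2.2 (hκlt _ (not_le.1 hc) i j)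
  obtain ⟨m, h1, h2, e1, e2⟩ := exists_common_position (κ := κ) (P := P)
    (differenceSequence_sorted c x) (differenceSequence_sorted c (x * t)) hlength
    ((mem_differenceSequence (δ := δ) c).2
      ⟨hκle, Or.inr ⟨_, hcous i, _, hcous j, hne, hfd⟩⟩)
    ((mem_differenceSequence (δ := δ) c).2
      ⟨by rwa [hlen], Or.inr ⟨_, hcous' i, _, hcous' j, hne, hfd⟩⟩)
    (fun m h h' => by
      have hs : ∀ n : ℤ, aType c (pAncestor S (M * (differenceSequence δ c x)[m]) (x * t ^ n)) =
          aType c (pAncestor S (M * (differenceSequence δ c (x * t))[m]) (x * t ^ (n + 1))) := by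
        intro n
        rw [hA _ (hcous n) m h h', mul_assoc, ← zpow_one_add, add_comm]
      refine ⟨fun hp i j => ?_, fun hp i j => ?_⟩
      · have := hp (i - 1) (j - 1)
        rwa [hs, hs, sub_add_cancel, sub_add_cancel] at this
      · rw [hs, hs]
        exact hp _ _)
    hκP hκlt
  -- Since κ has the same position in both sequences, the transferred entries compare generation κ
  -- with itself, and only the exponent moves by one.
  have hs : ∀ n : ℤ, aType c (pAncestor S (M * κ) (x * t ^ n)) =
      aType c (pAncestor S (M * κ) (x * t ^ (n + 1))) := by
    intro n
    have := hA _ (hcous n) m h1 h2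
    rwa [e1, e2, mul_assoc, ← zpow_one_add, add_comm] at this
  have hconst : ∀ n : ℤ, aType c (pAncestor S (M * κ) (x * t ^ n)) =
      aType c (pAncestor S (M * κ) (x * t ^ (0 : ℤ))) := by
    intro n
    induction n using Int.induction_on with
    | zero => rfl
    | succ n ih => rw [← hs, ih]
    | pred n ih => rw [hs, sub_add_cancel, ih]
  exact hκP fun i j => by rw [hconst, hconst j]

end Rigidity

/-! ### Points of polyhedra through the supports of their barycentric coordinates. -/

section Simplexes

variable {V W : Type*}

theorem support_subset_of_mem_closedSimplex {s : Finset V} {p : V → ℝ} (hp : p ∈ closedSimplex s) :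
    Function.support p ⊆ s := fun v hv => by
  by_contra h
  exact hv (hp.2.1 v h)

theorem mem_closedSimplex_of_support {s t : Finset V} {p : V → ℝ} (hp : p ∈ closedSimplex s)
    (h : Function.support p ⊆ t) : p ∈ closedSimplex t := by
  classical
  have h0 : ∀ v, v ∉ t → p v = 0 := fun v hv => by
    by_contra hc
    exact hv (h hc)
  refine ⟨hp.1, h0, ?_⟩
  rw [← hp.2.2, Finset.sum_subset (Finset.subset_union_right (s₁ := s)) fun v _ hv => h0 v hv,
    Finset.sum_subset (Finset.subset_union_left (s₂ := t)) fun v _ hv => hp.2.1 v hv]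

theorem exists_support_eq {s : Finset V} {p : V → ℝ} (hp : p ∈ closedSimplex s) :
    ∃ t ⊆ s, t.Nonempty ∧ Function.support p = t := by
  classical
  refine ⟨s.filter fun v => p v ≠ 0, Finset.filter_subset _ _, ?_, ?_⟩
  · by_contra h
    rw [Finset.not_nonempty_iff_eq_empty, Finset.filter_eq_empty_iff] at h
    have := hp.2.2
    rw [Finset.sum_eq_zero fun v hv => by simpa using h hv] at this
    exact zero_ne_one this
  · ext v
    have := @support_subset_of_mem_closedSimplex _ _ _ hp v
    simp only [Function.mem_support, Finset.coe_filter, Set.mem_ofPred_eq] at *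
    tauto

theorem support_barycentre (s : Finset V) : Function.support (barycentre s) = s := by
  ext v
  simp only [barycentre, Function.mem_support]
  by_cases hv : v ∈ s
  · simp [hv, Finset.ne_empty_of_mem hv]
  · simp [hv]

theorem barycentre_injective : Function.Injective (barycentre (V := V)) := fun s t h => by
  have := support_barycentre s
  rw [h, support_barycentre] at this
  exact_mod_cast this.symm

theorem vertexPoint_mem {s : Finset V} {v : V} (hv : v ∈ s) : vertexPoint v ∈ closedSimplex s := by
  classical
  refine ⟨fun w => ?_, fun w hw => ?_, ?_⟩
  · by_cases h : w = v
    · subst h; simp [vertexPoint]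
    · simp [vertexPoint, h]
  · have h : w ≠ v := fun h => hw (h ▸ hv)
    simp [vertexPoint, h]
  · unfold vertexPoint
    rw [Finset.sum_pi_single']
    simp [hv]

theorem mem_of_vertexPoint_mem {s : Finset V} {v : V} (h : vertexPoint v ∈ closedSimplex s) :
    v ∈ s := by
  classical
  by_contra hc
  simpa [vertexPoint] using h.2.1 v hc

/-- All terms are nonnegative, so nothing cancels and supports simply unite. -/
theorem mem_support_affineExtension {s t : Finset V} {p : V → ℝ} {b : V → W → ℝ}
    (hp : p ∈ closedSimplex t) (hs : Function.support p = s) (hb : ∀ u w, 0 ≤ b u w) (w : W) :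
    affineExtension b p w ≠ 0 ↔ ∃ u ∈ s, b u w ≠ 0 := by
  have hnn : ∀ u ∈ t, 0 ≤ p u * b u w := fun u _ => mul_nonneg (hp.1 u) (hb u w)
  have hσ : ∀ u, u ∈ s ↔ p u ≠ 0 := fun u => by
    rw [← Function.mem_support, hs, Finset.mem_coe]
  rw [affineExtension_eq_sum _ hp, Ne, Finset.sum_eq_zero_iff_of_nonneg hnn]
  push Not
  constructor
  · rintro ⟨u, _, h⟩
    exact ⟨u, (hσ u).2 (left_ne_zero_of_mul h), right_ne_zero_of_mul h⟩
  · rintro ⟨u, hu, hw⟩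
    exact ⟨u, support_subset_of_mem_closedSimplex hp ((hσ u).1 hu), mul_ne_zero ((hσ u).1 hu) hw⟩

theorem affineExtension_vertexPoint (b : V → W → ℝ) (v : V) :
    affineExtension b (vertexPoint v) = b v := by
  classical
  funext w
  rw [affineExtension_eq_sum b (vertexPoint_mem (Finset.mem_singleton_self v))]
  simp [vertexPoint]

theorem convexComb_mem_closedSimplex {s : Finset V} {p q : V → ℝ} {t : ℝ} (hp : p ∈ closedSimplex s)
    (hq : q ∈ closedSimplex s) (ht0 : 0 ≤ t) (ht1 : t ≤ 1) :
    (1 - t) • p + t • q ∈ closedSimplex s := by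
  refine ⟨fun v => ?_, fun v hv => ?_, ?_⟩
  · exact add_nonneg (mul_nonneg (by linarith) (hp.1 v)) (mul_nonneg ht0 (hq.1 v))
  · simp [hp.2.1 v hv, hq.2.1 v hv]
  · simp only [Pi.add_apply, Pi.smul_apply, smul_eq_mul, Finset.sum_add_distrib,
      ← Finset.mul_sum, hp.2.2, hq.2.2]
    ring

theorem affineExtension_convexComb (b : V → W → ℝ) {s : Finset V} {p q r : V → ℝ} {t : ℝ}
    (hp : p ∈ closedSimplex s) (hq : q ∈ closedSimplex s) (ht0 : 0 ≤ t) (ht1 : t ≤ 1)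
    (hr : r = (1 - t) • p + t • q) :
    affineExtension b r = (1 - t) • affineExtension b p + t • affineExtension b q := by
  subst hr
  funext w
  simp only [Pi.add_apply, Pi.smul_apply, smul_eq_mul]
  rw [affineExtension_eq_sum _ hp, affineExtension_eq_sum _ hq,
    affineExtension_eq_sum _ (convexComb_mem_closedSimplex hp hq ht0 ht1),
    Finset.mul_sum, Finset.mul_sum, ← Finset.sum_add_distrib]
  refine Finset.sum_congr rfl fun v _ => ?_
  simp only [Pi.add_apply, Pi.smul_apply, smul_eq_mul]
  ring

theorem mem_realization_of_face {K : PreAbstractSimplicialComplex V} {s : Finset V} (hs : s ∈ K.faces)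
    {p : V → ℝ} (hp : p ∈ closedSimplex s) : p ∈ realization K := ⟨s, hs, hp⟩

theorem face_subset {K : PreAbstractSimplicialComplex V} {s t : Finset V} (hs : s ∈ K.faces)
    (h : t ⊆ s) (ht : t.Nonempty) : t ∈ K.faces :=
  (K.isRelLowerSet_faces hs).2 h ht

theorem face_nonempty {K : PreAbstractSimplicialComplex V} {s : Finset V} (hs : s ∈ K.faces) :
    s.Nonempty :=
  (K.isRelLowerSet_faces hs).1

theorem vertexPoint_mem_realization {K : PreAbstractSimplicialComplex V} {v : V} :
    vertexPoint v ∈ realization K ↔ {v} ∈ K.faces := by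
  refine ⟨?_, fun h => ⟨_, h, vertexPoint_mem (Finset.mem_singleton_self v)⟩⟩
  rintro ⟨s, hs, h⟩
  exact face_subset hs (by simpa using mem_of_vertexPoint_mem h) (by simp)

end Simplexes

/-! ### Nerve systems: combinatorics of preimages, and translation by group elements. -/

section NerveSystem

variable {X : Type*}

open Classical in
/-- The vertices of the smallest simplex which contains the image of the simplex `σ`. -/
noncomputable def hull {𝒱 : Set (Set X)} (h : 𝒱.Finite) (σ : Finset (Set X)) : Finset (Set X) :=
  σ.biUnion (parents h)

theorem mem_parents {𝒱 : Set (Set X)} (h : 𝒱.Finite) {u w : Set X} :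
    w ∈ parents h u ↔ w ∈ 𝒱 ∧ u ⊆ w := by
  simp [parents]

theorem mem_hull {𝒱 : Set (Set X)} (h : 𝒱.Finite) {σ : Finset (Set X)} {w : Set X} :
    w ∈ hull h σ ↔ ∃ u ∈ σ, w ∈ parents h u := by
  classical
  simp [hull]

theorem hull_mono {𝒱 : Set (Set X)} (h : 𝒱.Finite) {σ τ : Finset (Set X)} (hs : σ ⊆ τ) :
    hull h σ ⊆ hull h τ := fun w hw => by
  rw [mem_hull] at *
  obtain ⟨u, hu, hw⟩ := hw
  exact ⟨u, hs hu, hw⟩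

theorem support_nerveMap {𝒱 : Set (Set X)} (h𝒱 : 𝒱.Finite) {σ τ : Finset (Set X)}
    {p : Set X → ℝ} (hp : p ∈ closedSimplex τ) (hs : Function.support p = σ) :
    Function.support (affineExtension (fun u => barycentre (parents h𝒱 u)) p) = hull h𝒱 σ := by
  ext w
  have hnn : ∀ u w, 0 ≤ barycentre (parents h𝒱 u) w := fun u w =>
    Set.indicator_nonneg (fun _ _ => by positivity) _
  rw [Function.mem_support, mem_support_affineExtension hp hs hnn, Finset.mem_coe, mem_hull]
  simp only [← Function.mem_support, support_barycentre, Finset.mem_coe]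

variable (𝒰 : ℕ → Set (Set X)) (hfin : ∀ n, (𝒰 n).Finite)
    (href : ∀ n, ∀ u ∈ 𝒰 (n + 1), ∃ w ∈ 𝒰 n, u ⊆ w)

/-- The vertices of the smallest simplex of `K i` which contains the image of the simplex `σ`
of `K (i + k)`. -/
noncomputable def iterHull (i : ℕ) : ℕ → Finset (Set X) → Finset (Set X)
  | 0, σ => σ
  | k + 1, σ => iterHull i k (hull (hfin (i + k)) σ)

theorem iterHull_mono (i k : ℕ) : ∀ {σ τ : Finset (Set X)}, σ ⊆ τ →
    iterHull 𝒰 hfin i k σ ⊆ iterHull 𝒰 hfin i k τ := by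
  induction k with
  | zero => exact fun h => h
  | succ k ih => exact fun h => ih (hull_mono _ h)

/-- A point common to all members of σ lies in every set that contains one of them. -/
theorem hull_mem_faces (n : ℕ) {σ : Finset (Set X)}
    (hσ : σ ∈ (nerve (𝒰 (n + 1))).faces) (href : ∀ u ∈ 𝒰 (n + 1), ∃ w ∈ 𝒰 n, u ⊆ w) :
    hull (hfin n) σ ∈ (nerve (𝒰 n)).faces := by
  obtain ⟨⟨u, hu⟩, hsub, y, hy⟩ := hσ
  refine ⟨?_, ?_, y, ?_⟩
  · obtain ⟨w, hw, huw⟩ := href u (hsub hu)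
    exact ⟨w, (mem_hull _).2 ⟨u, hu, (mem_parents _).2 ⟨hw, huw⟩⟩⟩
  · intro w hw
    obtain ⟨u, hu, hw⟩ := (mem_hull _).1 hw
    exact ((mem_parents _).1 hw).1
  · intro w hw
    obtain ⟨u, hu, hw⟩ := (mem_hull _).1 hw
    exact ((mem_parents _).1 hw).2 (hy u hu)

theorem support_comp (i k : ℕ) :
    ∀ (p : realization ((nerveSystem 𝒰 hfin href).K (i + k))) (σ : Finset (Set X)),
    Function.support (ι := Set X) p.1 = σ →
    Function.support (ι := Set X) ((nerveSystem 𝒰 hfin href).comp i k p).1 =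
      iterHull 𝒰 hfin i k σ := by
  induction k with
  | zero => exact fun p σ h => h
  | succ k ih =>
    intro p σ h
    obtain ⟨τ, _, hp⟩ := p.2
    exact ih ((nerveSystem 𝒰 hfin href).f (i + k) p) _ (support_nerveMap (hfin (i + k)) hp h)

/-- Lying in a closed simplex of the target is a condition on the support, and among the points of σ
the barycentre has an image of largest support, so it decides. -/
theorem mem_preimageFaces_comp (i k : ℕ) {s σ : Finset (Set X)} :
    σ ∈ PolyhedralSystem.preimageFaces ((nerveSystem 𝒰 hfin href).comp i k) s ↔
      σ ∈ (nerve (𝒰 (i + k))).faces ∧ iterHull 𝒰 hfin i k σ ⊆ s := by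
  refine and_congr_right fun hσ => ⟨fun h => ?_, fun h p hp => ?_⟩
  · have hb : barycentre σ ∈ closedSimplex σ := barycentre_mem (face_nonempty hσ) subset_rfl
    have h1 := h ⟨barycentre σ, mem_realization_of_face hσ hb⟩ hb
    have h2 := support_subset_of_mem_closedSimplex h1
    have h3 := support_comp 𝒰 hfin href i k ⟨barycentre σ, mem_realization_of_face hσ hb⟩ σ
      (support_barycentre σ)
    exact Finset.coe_subset.1 (h3.symm.subset.trans h2)
  · obtain ⟨τ, hτ, hne, hs⟩ := exists_support_eq hp
    obtain ⟨ρ, _, hρ⟩ := ((nerveSystem 𝒰 hfin href).comp i k p).2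
    refine mem_closedSimplex_of_support hρ ?_
    exact (support_comp 𝒰 hfin href i k p τ hs).subset.trans
      (Finset.coe_subset.2 ((iterHull_mono 𝒰 hfin i k hτ).trans h))

theorem mem_preimageFaces_f (n : ℕ) {s σ : Finset (Set X)} :
    σ ∈ PolyhedralSystem.preimageFaces ((nerveSystem 𝒰 hfin href).f n) s ↔
      σ ∈ (nerve (𝒰 (n + 1))).faces ∧ hull (hfin n) σ ⊆ s :=
  mem_preimageFaces_comp 𝒰 hfin href n 1

theorem nerveSystem_isAffineSystem : (nerveSystem 𝒰 hfin href).IsAffineSystem := by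
  intro n σ hσ
  refine ⟨⟨hull (hfin n) σ, hull_mem_faces 𝒰 hfin n hσ (href n),
    (mem_preimageFaces_f 𝒰 hfin href n).2 ⟨hσ, subset_rfl⟩⟩, ?_⟩
  intro p q r t ht0 ht1 hp hq hr
  exact affineExtension_convexComb (V := Set X) _ hp hq ht0 ht1 hr

theorem nerveSystem_isBarycentric : (nerveSystem 𝒰 hfin href).IsBarycentric := by
  intro n (v : Set X) p hp
  have hv : {v} ∈ (nerve (𝒰 (n + 1))).faces := by
    have h : p.1 ∈ realization (nerve (𝒰 (n + 1))) := p.2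
    exact vertexPoint_mem_realization.1 (hp ▸ h)
  refine ⟨parents (hfin n) v, ?_, ?_⟩
  · have := hull_mem_faces 𝒰 hfin n hv (href n)
    rwa [hull, Finset.singleton_biUnion] at this
  · change affineExtension (V := Set X) _ p.1 = _
    rw [hp]
    exact affineExtension_vertexPoint _ v

theorem nerve_faces_finite {𝒱 : Set (Set X)} (h : 𝒱.Finite) : (nerve 𝒱).faces.Finite := by
  refine (Finset.finite_toSet h.toFinset.powerset).subset fun σ hσ => ?_
  simp only [Finset.coe_powerset, Set.mem_preimage, Set.mem_powerset_iff, Set.Finite.coe_toFinset]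
  exact hσ.2.1

section Action

variable {G : Type*} [Group G] [MulAction G X]

theorem simplicialExtension_smul (γ : G) (p : Set X → ℝ) (w : Set X) :
    simplicialExtension (fun u => γ • u) p w = p (γ⁻¹ • w) := by
  classical
  unfold simplicialExtension affineExtension vertexPoint
  rw [finsum_eq_single _ (γ⁻¹ • w)]
  · simp
  · intro v hv
    have : w ≠ γ • v := fun h => hv (by simp [h])
    simp [this]

open Classical in
theorem barycentre_smul (γ : G) (s : Finset (Set X)) (w : Set X) :
    barycentre (s.image fun u => γ • u) w = barycentre s (γ⁻¹ • w) := by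
  have h : w ∈ s.image (fun u => γ • u) ↔ γ⁻¹ • w ∈ s := by
    rw [Finset.mem_image]
    exact ⟨by rintro ⟨u, hu, rfl⟩; simpa using hu, fun h => ⟨_, h, by simp⟩⟩
  simp only [barycentre, Set.indicator_apply, Finset.mem_coe, h,
    Finset.card_image_of_injective s (MulAction.injective γ)]

-- Quasi-invariance provides the correspondence of parents only near suitable simplexes. It is
-- enough to have it on the support of p, since other coefficients vanish.
open Classical in
theorem nerveMap_smul {𝒱 𝒱' : Set (Set X)} (h : 𝒱.Finite) (h' : 𝒱'.Finite) (γ : G)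
    (p : Set X → ℝ)
    (hp : ∀ u, p u ≠ 0 → parents h' (γ • u) = (parents h u).image fun u => γ • u) :
    affineExtension (fun u => barycentre (parents h' u))
      (simplicialExtension (fun u => γ • u) p) =
    simplicialExtension (fun u => γ • u)
      (affineExtension (fun u => barycentre (parents h u)) p) := by
  funext w
  rw [simplicialExtension_smul]
  unfold affineExtension
  rw [← finsum_comp_equiv (MulAction.toPerm γ)]
  refine finsum_congr fun v => ?_
  rw [MulAction.toPerm_apply, simplicialExtension_smul, inv_smul_smul]
  by_cases hv : p v = 0
  · simp [hv]
  · simp only [hp v hv, barycentre_smul]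

end Action

end NerveSystem

/-! ### Shifts: partial translations between simplexes of the nerves. -/

section Shifts

variable {G : Type*} [Group G] {Q : ℕ} {X : Type*} {𝒯 : Type*}

/-- Left multiplication by `γ` maps the labelled graph of the simplex `s` at level `a` onto the
labelled graph of the simplex `s'` at level `b`. -/
def IsShift (S : Fin Q → G) (U : G → Set X) (T : G → 𝒯) (γ : G) (a : ℕ) (s : Finset (Set X)) (b : ℕ)
    (s' : Finset (Set X)) : Prop :=
  (∀ g ∈ graphVertices S U a s, γ * g ∈ graphVertices S U b s' ∧ T (γ * g) = T g) ∧
    ∀ g ∈ graphVertices S U b s', γ⁻¹ * g ∈ graphVertices S U a s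

variable {S : Fin Q → G} {U : G → Set X} {T : G → 𝒯} {γ γ' : G} {a b c : ℕ}
  {s s' s'' : Finset (Set X)}

theorem IsShift.refl (a : ℕ) (s : Finset (Set X)) : IsShift S U T 1 a s a s :=
  ⟨fun g hg => by simpa using hg, fun g hg => by simpa using hg⟩

theorem IsShift.symm (h : IsShift S U T γ a s b s') : IsShift S U T γ⁻¹ b s' a s := by
  refine ⟨fun g hg => ⟨h.2 g hg, ?_⟩, fun g hg => by simpa using (h.1 g hg).1⟩
  simpa using (h.1 _ (h.2 g hg)).2.symm

theorem IsShift.trans (h : IsShift S U T γ a s b s') (h' : IsShift S U T γ' b s' c s'') :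
    IsShift S U T (γ' * γ) a s c s'' := by
  refine ⟨fun g hg => ?_, fun g hg => ?_⟩
  · obtain ⟨h1, h2⟩ := h.1 g hg
    obtain ⟨h3, h4⟩ := h'.1 _ h1
    rw [mul_assoc]
    exact ⟨h3, h4.trans h2⟩
  · rw [mul_inv_rev, mul_assoc]
    exact h.2 _ (h'.2 g hg)

theorem IsShift.similar (h : IsShift S U T γ a s b s') : SimilarSimplexes S U T a b s s' := by
  refine ⟨⟨fun g => ⟨γ * g, (h.1 _ g.2).1⟩, fun g => ⟨γ⁻¹ * g, h.2 _ g.2⟩, fun g => by simp,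
    fun g => by simp⟩, fun g => (h.1 _ g.2).2, fun g g' _ => ?_⟩
  simp only [Equiv.coe_fn_mk]
  group

theorem exists_graphVertex {n : ℕ} {s : Finset (Set X)} (hs : s ∈ (nerve (level S U n)).faces) :
    (graphVertices S U n s).Nonempty := by
  obtain ⟨u, hu⟩ := hs.1
  obtain ⟨-, x, hx, rfl⟩ := hs.2.1 hu
  exact ⟨x, hx, hu⟩

open Classical in
theorem image_smul_image_inv_smul [MulAction G X] (γ : G) (σ : Finset (Set X)) :
    (σ.image fun u => γ⁻¹ • u).image (fun u => γ • u) = σ := by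
  simp only [Finset.image_image, Function.comp_def, smul_inv_smul, Finset.image_id']

variable [PseudoEMetricSpace X] [MulAction G X] {D : ℝ} {J : ℕ}

-- Equality of T at g and γg gives U (γg) = γ • U g, and every vertex of either simplex is
-- represented by some g.
open Classical in
theorem IsShift.eq_image (hU : IsQuasiInvariant S U T D J) (h : IsShift S U T γ a s b s')
    (hs : (s : Set (Set X)) ⊆ level S U a) (hs' : (s' : Set (Set X)) ⊆ level S U b) :
    s' = s.image fun u => γ • u := by
  ext w
  rw [Finset.mem_image]
  constructor
  · intro hw
    obtain ⟨-, g, hg, rfl⟩ := hs' hw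
    have h1 := h.2 g ⟨hg, hw⟩
    have h2 := hU.smul_eq γ _ (h.1 _ h1).2.symm
    rw [mul_inv_cancel_left] at h2
    exact ⟨_, h1.2, h2.symm⟩
  · rintro ⟨u, hu, rfl⟩
    obtain ⟨-, g, hg, rfl⟩ := hs hu
    obtain ⟨h1, h2⟩ := h.1 g ⟨hg, hu⟩
    rw [← hU.smul_eq γ _ h2.symm]
    exact h1.2

open Classical in
theorem IsShift.restrict (hU : IsQuasiInvariant S U T D J)
    (h : IsShift S U T γ a s b (s.image fun u => γ • u)) {t : Finset (Set X)} (ht : t ⊆ s) :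
    IsShift S U T γ a t b (t.image fun u => γ • u) := by
  refine ⟨fun g hg => ?_, fun g hg => ?_⟩
  · obtain ⟨h1, h2⟩ := h.1 g ⟨hg.1, ht hg.2⟩
    refine ⟨⟨h1.1, ?_⟩, h2⟩
    rw [hU.smul_eq γ _ h2.symm]
    exact Finset.mem_image_of_mem _ hg.2
  · have h1 := h.2 g ⟨hg.1, Finset.image_subset_image ht hg.2⟩
    have h2 := hU.smul_eq γ _ (h.1 _ h1).2.symm
    rw [mul_inv_cancel_left] at h2
    obtain ⟨u, hu, he⟩ := Finset.mem_image.1 hg.2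
    simp only [h2, smul_left_cancel_iff] at he
    exact ⟨h1.1, he ▸ hu⟩

open Classical in
/-- Parents of the vertices below a shifted simplex. -/
theorem IsShift.parents_smul (hS : IsSymmetricGenerating S) (hU : IsQuasiInvariant S U T D J)
    (h : IsShift S U T γ a s b s') {u : Set X} (hu : u.Nonempty)
    (hpar : parents (level_finite hS U a) u ⊆ s)
    (hne : (parents (level_finite hS U a) u).Nonempty) :
    parents (level_finite hS U b) (γ • u) =
      (parents (level_finite hS U a) u).image fun w => γ • w := by
  ext w
  rw [Finset.mem_image]
  constructor
  · intro hw
    obtain ⟨⟨hwne, y', hy', rfl⟩, hsub⟩ := (mem_parents _).1 hw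
    -- A parent of γ • u is not known in advance to be a translate. It meets the translate of a
    -- parent of u, because both contain γ • u, and the neighbour condition for γ⁻¹ then brings it
    -- back.
    obtain ⟨v, hv⟩ := hne
    have hvs := hpar hv
    obtain ⟨⟨-, y, hy, rfl⟩, huv⟩ := (mem_parents _).1 hv
    obtain ⟨h1, h2⟩ := h.1 y ⟨hy, hvs⟩
    have h3 := hU.smul_eq γ _ h2.symm
    have h4 : T (γ * y) = T (γ⁻¹ * (γ * y)) := by rw [inv_mul_cancel_left, h2]
    have h5 : (U (γ * y) ∩ U y').Nonempty := by
      rw [h3]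
      exact hu.smul_set.mono (Set.subset_inter (Set.smul_set_mono huv) hsub)
    obtain ⟨h6, h7⟩ := hU.smul_neighbour γ⁻¹ (γ * y) h4 y' (by rw [hy', h1.1]) h5
    rw [inv_mul_cancel_left] at h7
    refine ⟨γ⁻¹ • U y', (mem_parents _).2 ⟨⟨hwne.smul_set, γ⁻¹ * y', by rw [h7, hy], h6⟩, ?_⟩,
      by simp⟩
    rwa [Set.subset_smul_set_iff, inv_inv]
  · rintro ⟨v, hv, rfl⟩
    have hvs := hpar hv
    obtain ⟨⟨hvne, y, hy, rfl⟩, huv⟩ := (mem_parents _).1 hv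
    obtain ⟨h1, h2⟩ := h.1 y ⟨hy, hvs⟩
    exact (mem_parents _).2 ⟨⟨hvne.smul_set, γ * y, h1.1, hU.smul_eq γ _ h2.symm⟩,
      Set.smul_set_mono huv⟩

open Classical in
/-- A shift of a simplex extends to the simplexes below it. -/
theorem IsShift.child (hS : IsSymmetricGenerating S) (hU : IsQuasiInvariant S U T D J)
    {L : ℕ} (hL : 0 < L) (hJ : J ∣ L) {m n : ℕ}
    (h : IsShift S U T γ (m * L) s (n * L) s') {σ : Finset (Set X)}
    (hσ : σ ∈ (nerve (level S U ((m + 1) * L))).faces)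
    (hpar : hull (level_finite hS U (m * L)) σ ⊆ s) :
    σ.image (fun u => γ • u) ∈ (nerve (level S U ((n + 1) * L))).faces ∧
    IsShift S U T γ ((m + 1) * L) σ ((n + 1) * L) (σ.image fun u => γ • u) ∧
    hull (level_finite hS U (n * L)) (σ.image fun u => γ • u) =
      (hull (level_finite hS U (m * L)) σ).image fun u => γ • u := by
  obtain ⟨k, rfl⟩ := hJ
  have hk : 0 < k := Nat.pos_of_mul_pos_left hL
  obtain ⟨hne, hsub, p, hp⟩ := hσ
  have hparu : ∀ u ∈ σ, parents (level_finite hS U (m * (J * k))) u ⊆ s := fun u hu w hw =>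
    hpar ((mem_hull _).2 ⟨u, hu, hw⟩)
  have hparne : ∀ u ∈ σ, (parents (level_finite hS U (m * (J * k))) u).Nonempty := fun u hu => by
    obtain ⟨w, hw, huw⟩ := level_refines hU hL ⟨k, rfl⟩ m u (hsub hu)
    exact ⟨w, (mem_parents _).2 ⟨hw, huw⟩⟩
  -- Each vertex of σ is a child of a vertex of s, so the child condition translates it together
  -- with its type.
  have hv : ∀ x ∈ graphVertices S U ((m + 1) * (J * k)) σ,
      len S (γ * x) = (n + 1) * (J * k) ∧ T (γ * x) = T x ∧ U (γ * x) = γ • U x := by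
    rintro x ⟨hx, hxσ⟩
    obtain ⟨w, hw⟩ := hparne _ hxσ
    have hws := hparu _ hxσ hw
    obtain ⟨⟨-, y, hy, rfl⟩, hxy⟩ := (mem_parents _).1 hw
    obtain ⟨h1, h2⟩ := h.1 y ⟨hy, hws⟩
    have := hU.smul_child γ y h2.symm x k hk (by rw [hx, hy]; ring) (hsub hxσ).1 hxy
    refine ⟨?_, this.2⟩
    rw [this.1, h1.1]
    ring
  refine ⟨⟨hne.image _, ?_, γ • p, ?_⟩, ⟨fun x hx => ?_, fun g hg => ?_⟩, ?_⟩
  · intro w hw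
    obtain ⟨u, hu, rfl⟩ := Finset.mem_image.1 hw
    obtain ⟨hune, x, hx, rfl⟩ := hsub hu
    obtain ⟨h1, -, h3⟩ := hv x ⟨hx, hu⟩
    exact ⟨hune.smul_set, γ * x, h1, h3⟩
  · intro w hw
    obtain ⟨u, hu, rfl⟩ := Finset.mem_image.1 hw
    exact Set.smul_mem_smul_set (hp u hu)
  · obtain ⟨h1, h2, h3⟩ := hv x hx
    exact ⟨⟨h1, by rw [h3]; exact Finset.mem_image_of_mem _ hx.2⟩, h2⟩
  -- A set may have several representatives. The given g represents the same set as γx, so the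
  -- neighbour condition for γ⁻¹ applies and places γ⁻¹g at the right length.
  · obtain ⟨u, hu, he⟩ := Finset.mem_image.1 hg.2
    obtain ⟨hune, x, hx, rfl⟩ := hsub hu
    obtain ⟨h1, h2, h3⟩ := hv x ⟨hx, hu⟩
    have h4 : T (γ * x) = T (γ⁻¹ * (γ * x)) := by rw [inv_mul_cancel_left, h2]
    have h5 : (U (γ * x) ∩ U g).Nonempty := by
      rw [h3, ← he, Set.inter_self]
      exact hune.smul_set
    obtain ⟨h6, h7⟩ := hU.smul_neighbour γ⁻¹ (γ * x) h4 g (by rw [hg.1, h1]) h5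
    rw [inv_mul_cancel_left, hx] at h7
    refine ⟨h7, ?_⟩
    rw [h6, ← he]
    simpa using hu
  · ext w
    simp only [mem_hull, Finset.mem_image]
    constructor
    · rintro ⟨_, ⟨u, hu, rfl⟩, hw⟩
      rw [h.parents_smul hS hU (hsub hu).1 (hparu u hu) (hparne u hu), Finset.mem_image] at hw
      obtain ⟨v, hv, rfl⟩ := hw
      exact ⟨v, ⟨u, hu, hv⟩, rfl⟩
    · rintro ⟨v, ⟨u, hu, hv⟩, rfl⟩
      refine ⟨_, ⟨u, hu, rfl⟩, ?_⟩
      rw [h.parents_smul hS hU (hsub hu).1 (hparu u hu) (hparne u hu)]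
      exact Finset.mem_image_of_mem _ hv

open Classical in
/-- A shift of a simplex extends to all simplexes in its successive preimages. -/
theorem IsShift.descend (hS : IsSymmetricGenerating S) (hU : IsQuasiInvariant S U T D J)
    {L : ℕ} (hL : 0 < L) (hJ : J ∣ L) {i j : ℕ} (h : IsShift S U T γ (i * L) s (j * L) s')
    (hs : (s : Set (Set X)) ⊆ level S U (i * L)) (hs' : s' ∈ (nerve (level S U (j * L))).faces)
    (k : ℕ) : ∀ σ ∈ (nerve (level S U ((i + k) * L))).faces,
      iterHull (fun n => level S U (n * L)) (fun n => level_finite hS U (n * L)) i k σ ⊆ s →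
      σ.image (fun u => γ • u) ∈ (nerve (level S U ((j + k) * L))).faces ∧
      IsShift S U T γ ((i + k) * L) σ ((j + k) * L) (σ.image fun u => γ • u) ∧
      iterHull (fun n => level S U (n * L)) (fun n => level_finite hS U (n * L)) j k
        (σ.image fun u => γ • u) ⊆ s' := by
  have heq := h.eq_image hU hs hs'.2.1
  induction k with
  | zero =>
    intro σ hσ hsub
    have hi : σ.image (fun u => γ • u) ⊆ s' := heq ▸ Finset.image_subset_image hsub
    exact ⟨face_subset hs' hi (hσ.1.image _), (heq ▸ h).restrict hU hsub, hi⟩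
  | succ k ih =>
    intro σ hσ hsub
    have h1 := hull_mem_faces (fun n => level S U (n * L)) (fun n => level_finite hS U (n * L))
      (i + k) hσ (level_refines hU hL hJ (i + k))
    obtain ⟨h2, h3, h4⟩ := ih _ h1 hsub
    obtain ⟨h5, h6, h7⟩ := h3.child hS hU hL hJ hσ subset_rfl
    refine ⟨h5, h6, ?_⟩
    rw [← h7] at h4
    exact h4

end Shifts

/-! ### Refined simplex types, the ladders and the distinct types property. -/

section Types

variable {G : Type*} [Group G] {Q : ℕ} {X : Type*} {𝒯 : Type*} [PseudoEMetricSpace X]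
  [MulAction G X] {S : Fin Q → G} {U : G → Set X} {T : G → 𝒯} {D : ℝ} {J : ℕ} {L : ℕ}
  (hS : IsSymmetricGenerating S) (hU : IsQuasiInvariant S U T D J) (hL : 0 < L) (hJ : J ∣ L)

/-- The simplexes of all the nerves. -/
abbrev AllFaces (S : Fin Q → G) (U : G → Set X) (L : ℕ) :=
  Σ n : ℕ, (nerve (level S U (n * L))).faces

/-- The level and the vertices of the smallest simplex which contains the image of a simplex
under the bonding map; a simplex of the first complex is left unchanged. -/
noncomputable def previous (L : ℕ) : ℕ → Finset (Set X) → ℕ × Finset (Set X)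
  | 0, σ => (0, σ)
  | n + 1, σ => (n, hull (level_finite hS U (n * L)) σ)

/-- Equality of the refined simplex types. -/
def SameType (T : G → 𝒯) (L : ℕ) (x y : AllFaces S U L) : Prop :=
  (x.1 = 0 ↔ y.1 = 0) ∧ ∃ γ, IsShift S U T γ (x.1 * L) x.2.1 (y.1 * L) y.2.1 ∧
    IsShift S U T γ ((previous (U := U) hS L x.1 x.2.1).1 * L)
      (previous (U := U) hS L x.1 x.2.1).2
      ((previous (U := U) hS L y.1 y.2.1).1 * L) (previous (U := U) hS L y.1 y.2.1).2

/-- The equivalence relation whose classes are the refined simplex types. -/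
def typeSetoid (T : G → 𝒯) (L : ℕ) : Setoid (AllFaces S U L) where
  r := SameType hS T L
  iseqv :=
    { refl := fun _ => ⟨Iff.rfl, 1, IsShift.refl _ _, IsShift.refl _ _⟩
      symm := fun ⟨h0, γ, h1, h2⟩ => ⟨h0.symm, γ⁻¹, h1.symm, h2.symm⟩
      trans := fun ⟨h0, γ, h1, h2⟩ ⟨h0', γ', h1', h2'⟩ =>
        ⟨h0.trans h0', γ' * γ, h1.trans h1', h2.trans h2'⟩ }

include hU in
theorem wdist_le_of_graphVertices {n : ℕ} {s : Finset (Set X)}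
    (hs : s ∈ (nerve (level S U n)).faces) {x y : G} (hx : x ∈ graphVertices S U n s)
    (hy : y ∈ graphVertices S U n s) : (wdist S x y : ℝ) ≤ D := by
  obtain ⟨p, hp⟩ := hs.2.2
  exact hU.near x y (hx.1.trans hy.1.symm) ⟨p, hp _ hx.2, hp _ hy.2⟩

open Classical in
/-- The labelled graph of a simplex, as seen from one of its vertices. -/
noncomputable def shape (T : G → 𝒯) (D : ℝ) (x : AllFaces S U L) :
    {z : G // (len S z : ℝ) ≤ D} → Option 𝒯 := fun z =>
  let o := (exists_graphVertex x.2.2).some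
  if o * z ∈ graphVertices S U (x.1 * L) x.2.1 then some (T (o * z)) else none

-- With chosen base vertices o of x and o' of y, equal shapes are matched by γ = o' o⁻¹. A simplex
-- has diameter at most D, so its shape sees all of its vertices.
include hU in
theorem exists_isShift_of_shape_eq {x y : AllFaces S U L} (h : shape T D x = shape T D y) :
    ∃ γ, IsShift S U T γ (x.1 * L) x.2.1 (y.1 * L) y.2.1 := by
  have key : ∀ {x y : AllFaces S U L}, shape T D x = shape T D y →
      ∀ g ∈ graphVertices S U (x.1 * L) x.2.1,
      (exists_graphVertex y.2.2).some * (exists_graphVertex x.2.2).some⁻¹ * g ∈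
        graphVertices S U (y.1 * L) y.2.1 ∧
      T ((exists_graphVertex y.2.2).some * (exists_graphVertex x.2.2).some⁻¹ * g) = T g := by
    intro x y h g hg
    have hd := wdist_le_of_graphVertices hU x.2.2 (exists_graphVertex x.2.2).some_mem hg
    have h1 := congrFun h ⟨_, hd⟩
    simp only [shape, mul_inv_cancel_left, hg, if_true] at h1
    rw [mul_assoc]
    split_ifs at h1 with h2
    exact ⟨h2, (Option.some.inj h1).symm⟩
  exact ⟨_, key h, fun g hg => by simpa [mul_inv_rev] using (key h.symm g hg).1⟩

-- Shifting the hull of σ to the representative of its shape moves σ, without changing its type,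
-- into one of finitely many nerves, each of which is finite.
include hU hL hJ in
open Classical in
theorem finite_typeQuotient : Finite (Quotient (typeSetoid (U := U) hS T L)) := by
  have := hU.finite_types
  have hD := (ball_finite hS D).to_subtype
  have : Finite ({z : G // (len S z : ℝ) ≤ D} → Option 𝒯) :=
    @Pi.finite _ _ hD _
  have hfin : ∀ n, Finite (nerve (level S U (n * L))).faces := fun n =>
    (nerve_faces_finite (level_finite hS U (n * L))).to_subtype
  -- representatives of all shapes
  let rep : Set.range (shape (S := S) (U := U) (L := L) T D) → AllFaces S U L := fun f => f.2.choose
  have hrep : ∀ f, shape T D (rep f) = f.1 := fun f => f.2.choose_spec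
  let src := (nerve (level S U (0 * L))).faces ⊕
    Σ f : Set.range (shape (S := S) (U := U) (L := L) T D),
      (nerve (level S U (((rep f).1 + 1) * L))).faces
  let F : src → Quotient (typeSetoid (U := U) hS T L) := fun z => match z with
    | Sum.inl σ => Quotient.mk _ ⟨0, σ⟩
    | Sum.inr z => Quotient.mk _ ⟨(rep z.1).1 + 1, z.2⟩
  refine Finite.of_surjective F fun q => ?_
  induction q using Quotient.inductionOn with
  | h x =>
    obtain ⟨n, σ⟩ := x
    cases n with
    | zero => exact ⟨Sum.inl σ, rfl⟩
    | succ n =>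
      have hface := hull_mem_faces (fun n => level S U (n * L))
        (fun n => level_finite hS U (n * L)) n σ.2 (level_refines hU hL hJ n)
      let y : AllFaces S U L := ⟨n, _, hface⟩
      let f : Set.range (shape (S := S) (U := U) (L := L) T D) := ⟨shape T D y, y, rfl⟩
      obtain ⟨γ, hγ⟩ := exists_isShift_of_shape_eq hU (x := y) (y := rep f) (hrep f).symm
      obtain ⟨h1, h2, h3⟩ := hγ.child hS hU hL hJ σ.2 subset_rfl
      refine ⟨Sum.inr ⟨f, _, h1⟩, Quotient.sound ?_⟩
      refine Setoid.symm' _ ⟨by simp, γ, h2, ?_⟩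
      simp only [previous]
      rw [h3, ← hγ.eq_image hU hface.2.1 (rep f).2.2.2.1]
      exact hγ

-- This is why the ladder maps preserve types. For k > 0 the hull of σ still lies over s and is
-- shifted by `IsShift.descend`. For k = 0 and i > 0 it lies in the hull of s, and the shift of that
-- hull has to be part of the hypothesis.
open Classical in
include hU hL hJ in
theorem sameType_descend {i j : ℕ} (s : (nerve (level S U (i * L))).faces)
    (s' : (nerve (level S U (j * L))).faces) {γ : G} (h0 : i = 0 ↔ j = 0)
    (h1 : IsShift S U T γ (i * L) s.1 (j * L) s'.1)
    (h2 : IsShift S U T γ ((previous (U := U) hS L i s.1).1 * L) (previous (U := U) hS L i s.1).2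
      ((previous (U := U) hS L j s'.1).1 * L) (previous (U := U) hS L j s'.1).2)
    (k : ℕ) (σ : Finset (Set X)) (hσ : σ ∈ (nerve (level S U ((i + k) * L))).faces)
    (hσ' : σ.image (fun u => γ • u) ∈ (nerve (level S U ((j + k) * L))).faces)
    (hsub : iterHull (fun n => level S U (n * L)) (fun n => level_finite hS U (n * L)) i k σ ⊆ s.1) :
    SameType hS T L ⟨i + k, σ, hσ⟩ ⟨j + k, _, hσ'⟩ := by
  have hd := fun k => h1.descend hS hU hL hJ s.2.2.1 s'.2 k
  refine ⟨by simp only [Nat.add_eq_zero_iff, h0], γ, (hd k σ hσ hsub).2.1, ?_⟩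
  cases k with
  | zero =>
    rcases Nat.eq_zero_or_pos i with rfl | hi
    · obtain rfl : j = 0 := h0.1 rfl
      exact (hd 0 σ hσ hsub).2.1
    · obtain ⟨i, rfl⟩ := Nat.exists_eq_succ_of_ne_zero hi.ne'
      obtain ⟨j, rfl⟩ := Nat.exists_eq_succ_of_ne_zero (fun h => hi.ne' (h0.2 h))
      simp only [Nat.succ_eq_add_one, previous] at h2 ⊢
      have hf := hull_mem_faces (fun n => level S U (n * L))
        (fun n => level_finite hS U (n * L)) i s.2 (level_refines hU hL hJ i)
      have hf' := hull_mem_faces (fun n => level S U (n * L))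
        (fun n => level_finite hS U (n * L)) j s'.2 (level_refines hU hL hJ j)
      have heq := h2.eq_image hU hf.2.1 hf'.2.1
      have hsub' : hull (level_finite hS U (i * L)) σ ⊆ hull (level_finite hS U (i * L)) s.1 :=
        hull_mono _ hsub
      obtain ⟨-, -, h8⟩ := h2.child hS hU hL hJ hσ hsub'
      rw [h8]
      rw [heq] at h2
      exact h2.restrict hU hsub'
  | succ k =>
    have hf := hull_mem_faces (fun n => level S U (n * L))
      (fun n => level_finite hS U (n * L)) (i + k) hσ (level_refines hU hL hJ (i + k))
    obtain ⟨-, h8, -⟩ := hd k _ hf hsub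
    obtain ⟨-, -, h9⟩ := h8.child hS hU hL hJ hσ subset_rfl
    change IsShift S U T γ ((i + k) * L) (hull _ σ) ((j + k) * L) (hull _ (σ.image _))
    rw [h9]
    exact h8

-- In every stage the isomorphism is u ↦ γ • u; surjectivity comes from the inverse shift.
open Classical in
theorem exists_ladder (x y : AllFaces S U L) (h : SameType hS T L x y) {𝒯' : Type*}
    (T' : (coverNerveSystem hS hU hL hJ).SimplexTypes 𝒯')
    (hT' : ∀ x y : AllFaces S U L, SameType hS T L x y → T' x.1 x.2 = T' y.1 y.2) :
    (coverNerveSystem hS hU hL hJ).Ladder T' (i := x.1) (j := y.1) x.2 y.2 := by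
  obtain ⟨i, s⟩ := x
  obtain ⟨j, s'⟩ := y
  obtain ⟨h0, γ, h1, h2⟩ := h
  simp only at h0 h1 h2
  have hd := fun k => h1.descend hS hU hL hJ s.2.2.1 s'.2 k
  have hd' := fun k => h1.symm.descend hS hU hL hJ s'.2.2.1 s.2 k
  have hpre := fun i k s σ => mem_preimageFaces_comp (fun n => level S U (n * L))
    (fun n => level_finite hS U (n * L)) (level_refines hU hL hJ) i k (s := s) (σ := σ)
  refine ⟨fun k (u : Set X) => γ • u, fun k => ⟨?_, ?_, ?_, ?_⟩, ?_, ?_⟩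
  · exact fun u _ v _ h => MulAction.injective (α := G) (β := Set X) γ h
  · intro σ hσ
    obtain ⟨h3, h4⟩ := (hpre _ _ _ _).1 hσ
    exact (hpre _ _ _ _).2 ⟨(hd k σ h3 h4).1, (hd k σ h3 h4).2.2⟩
  · exact (Finset.image_injective (MulAction.injective (α := G) (β := Set X) γ)).injOn
  · intro σ hσ
    obtain ⟨h3, h4⟩ := (hpre _ _ _ _).1 hσ
    obtain ⟨h5, -, h7⟩ := hd' k σ h3 h4
    exact ⟨_, (hpre _ _ _ _).2 ⟨h5, h7⟩, image_smul_image_inv_smul γ σ⟩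
  · rintro k ⟨σ, hσ⟩ ⟨σ', hσ'⟩ hmem he
    obtain ⟨h3, h4⟩ := (hpre _ _ _ _).1 hmem
    obtain rfl : σ' = Finset.image (fun u : Set X => γ • u) σ := he
    exact (hT' _ _ (sameType_descend hS hU hL hJ s s' h0 h1 h2 k σ hσ hσ' h4)).symm
  · intro k p q hp hq
    change affineExtension (V := Set X) _ q.1 = _
    rw [hq]
    refine nerveMap_smul _ _ γ p.1 fun u hu => ?_
    -- The simplex τ around p need not lie over s, but the support of p spans a face that does.
    obtain ⟨τ, hτ, hpτ⟩ := p.2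
    obtain ⟨σ, hsub, hne, hsupp⟩ : ∃ σ : Finset (Set X), σ ⊆ τ ∧ σ.Nonempty ∧
      Function.support (ι := Set X) p.1 = σ := exists_support_eq (V := Set X) hpτ
    have hσ : σ ∈ (nerve (level S U ((i + k + 1) * L))).faces := face_subset hτ hsub hne
    have h3 := support_comp (fun n => level S U (n * L)) (fun n => level_finite hS U (n * L))
      (level_refines hU hL hJ) i (k + 1) p σ hsupp
    have h4 := Finset.coe_subset.1
      (h3.symm.subset.trans (support_subset_of_mem_closedSimplex hp))
    have hf := hull_mem_faces (fun n => level S U (n * L))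
      (fun n => level_finite hS U (n * L)) (i + k) hσ (level_refines hU hL hJ (i + k))
    obtain ⟨-, h8, -⟩ := hd k _ hf h4
    have huσ : u ∈ σ := Finset.mem_coe.1 (hsupp.subset hu)
    refine h8.parents_smul hS hU (hσ.2.1 huσ).1 (fun w hw => (mem_hull _).2 ⟨u, huσ, hw⟩) ?_
    obtain ⟨w, hw, huw⟩ := level_refines hU hL hJ (i + k) u (hσ.2.1 huσ)
    exact ⟨w, (mem_parents _).2 ⟨hw, huw⟩⟩

include hS hU in
theorem card_face_le {n : ℕ} {s : Finset (Set X)} (hs : s ∈ (nerve (level S U n)).faces) :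
    s.card ≤ {g : G | (len S g : ℝ) ≤ D}.ncard := by
  classical
  obtain ⟨x, hx⟩ := exists_graphVertex hs
  have hfin := ball_finite hS D
  rw [Set.ncard_eq_toFinset_card _ hfin]
  refine (Finset.card_le_card (t := hfin.toFinset.image fun z => U (x * z)) ?_).trans
    Finset.card_image_le
  intro u hu
  obtain ⟨-, y, hy, rfl⟩ := hs.2.1 hu
  rw [Finset.mem_image]
  refine ⟨x⁻¹ * y, ?_, by simp⟩
  rw [Set.Finite.mem_toFinset]
  exact wdist_le_of_graphVertices hU hs hx ⟨hy, hu⟩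

/-- If no shift moves an element of `G` a bounded distance along its sphere, the nerves have simplex
types which make them a Markov system with distinct types property. -/
theorem exists_markov_types
    (hrigid : ∀ x γ : G, len S (γ * x) = len S x → T (γ * x) = T x →
      (wdist S x (γ * x) : ℝ) ≤ D → γ = 1) :
    ∃ (m : ℕ) (T' : (coverNerveSystem hS hU hL hJ).SimplexTypes (Fin m)),
      (∀ n n' (s : ((coverNerveSystem hS hU hL hJ).K n).faces)
        (s' : ((coverNerveSystem hS hU hL hJ).K n').faces),
        T' n s = T' n' s' → SimilarSimplexes S U T (n * L) (n' * L) s.1 s'.1) ∧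
      (coverNerveSystem hS hU hL hJ).IsMarkov T' ∧
      (coverNerveSystem hS hU hL hJ).HasDistinctTypes T' := by
  classical
  have := finite_typeQuotient hS hU hL hJ
  obtain ⟨m, ⟨e⟩⟩ := Finite.exists_equiv_fin (Quotient (typeSetoid (U := U) hS T L))
  have hiff : ∀ x y : AllFaces S U L, e (Quotient.mk _ x) = e (Quotient.mk _ y) ↔
      SameType hS T L x y := fun x y => by
    rw [e.apply_eq_iff_eq, Quotient.eq]
    rfl
  refine ⟨m, fun n s => e (Quotient.mk _ ⟨n, s⟩), ?_, ?_, ?_⟩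
  · intro n n' s s' h
    obtain ⟨-, γ, h1, -⟩ := (hiff _ _).1 h
    exact h1.similar
  · refine ⟨inferInstance, fun n => nerve_faces_finite (level_finite hS U (n * L)),
      ⟨{g : G | (len S g : ℝ) ≤ D}.ncard, fun n s hs => ?_⟩,
      nerveSystem_isAffineSystem _ _ _, fun i j s s' h => ?_⟩
    · exact (card_face_le hS hU hs).trans (Nat.le_succ _)
    · exact exists_ladder hS hU hL hJ ⟨i, s⟩ ⟨j, s'⟩ ((hiff _ _).1 h) _ fun x y hxy =>
        (hiff _ _).2 hxy
  · intro n s σ σ' hσ hσ' h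
    obtain ⟨hσf, hσs⟩ := (mem_preimageFaces_f (fun n => level S U (n * L))
      (fun n => level_finite hS U (n * L)) (level_refines hU hL hJ) n).1 hσ
    obtain ⟨hσf', hσs'⟩ := (mem_preimageFaces_f (fun n => level S U (n * L))
      (fun n => level_finite hS U (n * L)) (level_refines hU hL hJ) n).1 hσ'
    obtain ⟨-, γ, h1, h2⟩ := (hiff _ _).1 h
    have hf := hull_mem_faces (fun n => level S U (n * L))
      (fun n => level_finite hS U (n * L)) n hσf (level_refines hU hL hJ n)
    -- The simplexes σ and σ' need not be close to each other, but their hulls both lie in s, so x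
    -- and γx are within D. This is the reason for recording the hull in the type.
    obtain ⟨x, hx⟩ := exists_graphVertex hf
    obtain ⟨hγx, hTx⟩ := h2.1 x hx
    have hγ : γ = 1 := hrigid x γ (hγx.1.trans hx.1.symm) hTx
      (wdist_le_of_graphVertices hU s.2 ⟨hx.1, hσs hx.2⟩ ⟨hγx.1, hσs' hγx.2⟩)
    have := h1.eq_image hU hσf.2.1 hσf'.2.1
    simp only [hγ, one_smul, Finset.image_id'] at this
    exact Subtype.ext this.symm

end Types

noncomputable section

/-! ### The rebuilding procedure on codes. -/

section Rebuild

abbrev StageCode := PolyhedralSystem.StageCode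

/-- The entry `e` describes the simplex whose only vertex has label `x`. -/
def IsSingle (x : ℕ) (e : List ℕ × ℕ) : Prop := e.1 ≠ [] ∧ ∀ y ∈ e.1, y = x

open Classical in
/-- The type of the vertex with label `x`. -/
def vertexType (C : StageCode) (x : ℕ) : ℕ := ((C.1.filter (IsSingle x ·)).map Prod.snd).headI

/-- The vertices labelled `x` in the stage `P` and `y` in the stage `C` have equal types. -/
def SameVertexType (P : StageCode) (x : ℕ) (C : StageCode) (y : ℕ) : Prop :=
  ∃ e ∈ P.1, ∃ e' ∈ C.1, IsSingle x e ∧ IsSingle y e' ∧ e.2 = e'.2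

open Classical in
/-- The labels of the vertices of the parent simplex of the vertex with label `x`. -/
def parentLabels (C : StageCode) (x : ℕ) : List ℕ := (C.2.filter (·.1 = x)).flatMap Prod.snd

open Classical in
/-- The labels in `l` of vertices of `P` which correspond by type to the labels in `l'` of vertices
of `C`. -/
def translate (P C : StageCode) (l l' : List ℕ) : List ℕ :=
  l.filter fun x => ∃ y ∈ l', SameVertexType P x C y

/-- The increasing list with the same members. -/
def canon (l : List ℕ) : List ℕ := (List.range (l.sum + 1)).filter (· ∈ l)

/-- Two consecutive stages of the initial part, and lists of labels of a simplex `s` and of a simplex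
of the first of these stages which has the same type as `s`. -/
abbrev Block := (StageCode × StageCode) × (List ℕ × List ℕ)

/-- The parent of a new vertex, modelled on the vertex with label `x`. -/
def newParent (P : StageCode) (B : Block) (x : ℕ) : List ℕ :=
  translate P B.1.1 B.2.1 (parentLabels B.1.2 x)

/-- The label of a new vertex, modelled on the vertex with label `x`. -/
def newLabel (P : StageCode) (B : Block) (x : ℕ) : ℕ :=
  -- With distinct types, a vertex is determined by its parent simplex and its type, so the copies
  -- of it made in different blocks receive the same label.
  Nat.pair (Encodable.encode (canon (newParent P B x))) (vertexType B.1.2 x)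

open Classical in
/-- The blocks needed to build the stage which follows `P`. -/
def blocks (c : List StageCode) (P : StageCode) : List Block :=
  -- A model in stage k is useful only if stage k + 1 is known too.
  (List.range (c.length - 1)).flatMap fun k => P.1.flatMap fun e =>
    ((c.getD k ([], [])).1.filter (·.2 = e.2)).map fun e' =>
      ((c.getD k ([], []), c.getD (k + 1) ([], [])), (e.1, e'.1))

open Classical in
/-- The simplexes of the second stage in a block which lie over the simplex of the first stage. -/
def liftable (B : Block) : List (List ℕ × ℕ) :=
  B.1.2.1.filter fun e => ∀ x ∈ e.1, ∀ y ∈ parentLabels B.1.2 x, y ∈ B.2.2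

/-- The code of the stage which follows the stage with code `P`. -/
def nextStage (c : List StageCode) (P : StageCode) : StageCode :=
  ((blocks c P).flatMap fun B => (liftable B).map fun e => (e.1.map (newLabel P B), e.2),
    (blocks c P).flatMap fun B => (liftable B).flatMap fun e =>
      e.1.map fun x => (newLabel P B x, newParent P B x))

/-- The codes of all stages, built from the code of an initial part. -/
def rebuild (c : List StageCode) : ℕ → StageCode
  | 0 => c.getD 0 ([], [])
  | n + 1 => if n + 1 < c.length then c.getD (n + 1) ([], []) else nextStage c (rebuild c n)

end Rebuild

/-! ### The procedure is primitive recursive. -/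

section Primitive

variable {α β : Type*} [Primcodable α] [Primcodable β]

theorem primrecPred_exists_mem {f : α → List β} {p : α → β → Prop} (hf : Primrec f)
    (hp : PrimrecRel p) : PrimrecPred fun a => ∃ b ∈ f a, p a b :=
  hp.swap.exists_mem_list.comp hf Primrec.id

theorem primrecPred_forall_mem {f : α → List β} {p : α → β → Prop} (hf : Primrec f)
    (hp : PrimrecRel p) : PrimrecPred fun a => ∀ b ∈ f a, p a b :=
  hp.swap.forall_mem_list.comp hf Primrec.id

theorem primrec_filter {f : α → List β} {p : α → β → Prop} [∀ a, DecidablePred (p a)]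
    (hf : Primrec f) (hp : PrimrecRel p) : Primrec fun a => (f a).filter (p a ·) := by
  have : DecidableRel (Function.swap p) := fun b a => inferInstanceAs (Decidable (p a b))
  exact (hp.swap.listFilter.comp hf Primrec.id).of_eq fun a =>
    List.filter_congr fun b _ => decide_eq_decide.2 Iff.rfl

theorem primrecPred_mem {f : α → List ℕ} {g : α → ℕ} (hf : Primrec f) (hg : Primrec g) :
    PrimrecPred fun a => g a ∈ f a :=
  (primrecPred_exists_mem hf (p := fun a b => b = g a)
    (Primrec.eq.comp Primrec.snd (hg.comp Primrec.fst))).of_eq fun a => by simp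

theorem primrecPred_isSingle {f : α → ℕ} {g : α → List ℕ × ℕ} (hf : Primrec f) (hg : Primrec g) :
    PrimrecPred fun a => IsSingle (f a) (g a) :=
  (Primrec.eq.comp (Primrec.fst.comp hg) (Primrec.const [])).not.and
    (primrecPred_forall_mem (Primrec.fst.comp hg)
      (Primrec.eq.comp Primrec.snd (hf.comp Primrec.fst)))

theorem primrec_vertexType {f : α → StageCode} {g : α → ℕ} (hf : Primrec f) (hg : Primrec g) :
    Primrec fun a => vertexType (f a) (g a) := by
  classical
  refine Primrec.list_headI.comp (Primrec.list_map (primrec_filter (Primrec.fst.comp hf) ?_)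
    (Primrec.snd.comp Primrec.snd).to₂)
  exact primrecPred_isSingle (hg.comp Primrec.fst) Primrec.snd

theorem primrecPred_sameVertexType {f g : α → StageCode} {x y : α → ℕ} (hf : Primrec f)
    (hx : Primrec x) (hg : Primrec g) (hy : Primrec y) :
    PrimrecPred fun a => SameVertexType (f a) (x a) (g a) (y a) := by
  refine primrecPred_exists_mem (Primrec.fst.comp hf) (primrecPred_exists_mem
    (Primrec.fst.comp (hg.comp Primrec.fst)) (PrimrecPred.and ?_ (PrimrecPred.and ?_ ?_)))
  · exact primrecPred_isSingle (hx.comp (Primrec.fst.comp Primrec.fst))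
      (Primrec.snd.comp Primrec.fst)
  · exact primrecPred_isSingle (hy.comp (Primrec.fst.comp Primrec.fst)) Primrec.snd
  · exact Primrec.eq.comp (Primrec.snd.comp (Primrec.snd.comp Primrec.fst))
      (Primrec.snd.comp Primrec.snd)

theorem primrec_parentLabels {f : α → StageCode} {g : α → ℕ} (hf : Primrec f) (hg : Primrec g) :
    Primrec fun a => parentLabels (f a) (g a) := by
  classical
  refine Primrec.list_flatMap (primrec_filter (Primrec.snd.comp hf) ?_)
    (Primrec.snd.comp Primrec.snd).to₂
  exact Primrec.eq.comp (Primrec.fst.comp Primrec.snd) (hg.comp Primrec.fst)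

theorem primrec_translate {f g : α → StageCode} {l l' : α → List ℕ} (hf : Primrec f)
    (hg : Primrec g) (hl : Primrec l) (hl' : Primrec l') :
    Primrec fun a => translate (f a) (g a) (l a) (l' a) := by
  classical
  refine primrec_filter hl (primrecPred_exists_mem (hl'.comp Primrec.fst) ?_)
  exact primrecPred_sameVertexType (hf.comp (Primrec.fst.comp Primrec.fst))
    (Primrec.snd.comp Primrec.fst) (hg.comp (Primrec.fst.comp Primrec.fst)) Primrec.snd

theorem primrec_canon {l : α → List ℕ} (hl : Primrec l) : Primrec fun a => canon (l a) := by
  have hsum : Primrec fun a => (l a).sum :=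
    Primrec.list_foldr hl (Primrec.const 0)
      (Primrec.nat_add.comp (Primrec.fst.comp Primrec.snd) (Primrec.snd.comp Primrec.snd)).to₂
  exact primrec_filter (Primrec.list_range.comp (Primrec.succ.comp hsum))
    (primrecPred_mem (hl.comp Primrec.fst) Primrec.snd)

theorem primrec_newParent {f : α → StageCode} {B : α → Block} {x : α → ℕ} (hf : Primrec f)
    (hB : Primrec B) (hx : Primrec x) : Primrec fun a => newParent (f a) (B a) (x a) :=
  primrec_translate hf (Primrec.fst.comp (Primrec.fst.comp hB))
    (Primrec.fst.comp (Primrec.snd.comp hB))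
    (primrec_parentLabels (Primrec.snd.comp (Primrec.fst.comp hB)) hx)

theorem primrec_newLabel {f : α → StageCode} {B : α → Block} {x : α → ℕ} (hf : Primrec f)
    (hB : Primrec B) (hx : Primrec x) : Primrec fun a => newLabel (f a) (B a) (x a) :=
  Primrec₂.natPair.comp (Primrec.encode.comp (primrec_canon (primrec_newParent hf hB hx)))
    (primrec_vertexType (Primrec.snd.comp (Primrec.fst.comp hB)) hx)

theorem primrec_blocks {c : α → List StageCode} {f : α → StageCode} (hc : Primrec c)
    (hf : Primrec f) : Primrec fun a => blocks (c a) (f a) := by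
  classical
  have hget : ∀ {γ : Type _} [Primcodable γ] {g : γ → α} {k : γ → ℕ}, Primrec g → Primrec k →
      Primrec fun z => (c (g z)).getD (k z) ([], []) := fun hg hk =>
    (Primrec.list_getD _).comp (hc.comp hg) hk
  refine Primrec.list_flatMap (Primrec.list_range.comp (Primrec.nat_sub.comp
    (Primrec.list_length.comp hc) (Primrec.const 1))) ?_
  refine Primrec.list_flatMap (Primrec.fst.comp (hf.comp Primrec.fst)) ?_
  refine Primrec.list_map (primrec_filter (Primrec.fst.comp (hget
    (Primrec.fst.comp Primrec.fst) (Primrec.snd.comp Primrec.fst))) ?_) ?_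
  · exact Primrec.eq.comp (Primrec.snd.comp Primrec.snd)
      (Primrec.snd.comp (Primrec.snd.comp Primrec.fst))
  · refine Primrec.pair (Primrec.pair (hget (Primrec.fst.comp (Primrec.fst.comp Primrec.fst))
      (Primrec.snd.comp (Primrec.fst.comp Primrec.fst))) (hget
      (Primrec.fst.comp (Primrec.fst.comp Primrec.fst)) (Primrec.succ.comp
      (Primrec.snd.comp (Primrec.fst.comp Primrec.fst))))) ?_
    exact Primrec.pair (Primrec.fst.comp (Primrec.snd.comp Primrec.fst))
      (Primrec.fst.comp Primrec.snd)

theorem primrec_liftable {B : α → Block} (hB : Primrec B) : Primrec fun a => liftable (B a) := by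
  classical
  have hC : Primrec fun a => (B a).1.2 := Primrec.snd.comp (Primrec.fst.comp hB)
  refine primrec_filter (Primrec.fst.comp hC) (primrecPred_forall_mem
    (Primrec.fst.comp Primrec.snd) (primrecPred_forall_mem (primrec_parentLabels
    (hC.comp (Primrec.fst.comp Primrec.fst)) Primrec.snd) ?_))
  exact primrecPred_mem (Primrec.snd.comp (Primrec.snd.comp (hB.comp
    (Primrec.fst.comp (Primrec.fst.comp Primrec.fst))))) Primrec.snd

theorem primrec_nextStage {c : α → List StageCode} {f : α → StageCode} (hc : Primrec c)
    (hf : Primrec f) : Primrec fun a => nextStage (c a) (f a) := by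
  refine Primrec.pair (Primrec.list_flatMap (primrec_blocks hc hf) (Primrec.list_map
    (primrec_liftable Primrec.snd) ?_)) (Primrec.list_flatMap (primrec_blocks hc hf)
    (Primrec.list_flatMap (primrec_liftable Primrec.snd) (Primrec.list_map
    (Primrec.fst.comp Primrec.snd) ?_)))
  · refine Primrec.pair (Primrec.list_map (Primrec.fst.comp Primrec.snd) ?_)
      (Primrec.snd.comp Primrec.snd)
    exact primrec_newLabel (hf.comp (Primrec.fst.comp (Primrec.fst.comp Primrec.fst)))
      (Primrec.snd.comp (Primrec.fst.comp Primrec.fst)) Primrec.snd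
  · have h1 : Primrec fun z : ((α × Block) × (List ℕ × ℕ)) × ℕ => f z.1.1.1 :=
      hf.comp (Primrec.fst.comp (Primrec.fst.comp Primrec.fst))
    have h2 : Primrec fun z : ((α × Block) × (List ℕ × ℕ)) × ℕ => z.1.1.2 :=
      Primrec.snd.comp (Primrec.fst.comp Primrec.fst)
    exact Primrec.pair (primrec_newLabel h1 h2 Primrec.snd) (primrec_newParent h1 h2 Primrec.snd)

theorem computable_rebuild : Computable₂ rebuild := by
  have h : Primrec₂ fun (c : List StageCode) (n : ℕ) =>
      (Nat.rec (c.getD 0 ([], [])) (fun n P => if n + 1 < c.length then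
        c.getD (n + 1) ([], []) else nextStage c P) n : StageCode) := by
    refine Primrec.nat_rec (f := fun c : List StageCode => c.getD 0 ([], []))
      (g := fun c q => if q.1 + 1 < c.length then c.getD (q.1 + 1) ([], []) else nextStage c q.2)
      ((Primrec.list_getD _).comp Primrec.id (Primrec.const 0)) ?_
    have hn : Primrec fun z : List StageCode × (ℕ × StageCode) => z.2.1 + 1 :=
      Primrec.succ.comp (Primrec.fst.comp Primrec.snd)
    exact Primrec.ite (Primrec.nat_lt.comp hn (Primrec.list_length.comp Primrec.fst))
      ((Primrec.list_getD _).comp Primrec.fst hn)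
      (primrec_nextStage Primrec.fst (Primrec.snd.comp Primrec.snd))
  refine (h.to_comp).of_eq fun z => ?_
  obtain ⟨c, n⟩ := z
  induction n with
  | zero => rfl
  | succ n ih =>
    simp only at ih
    simp only [rebuild, ih]

end Primitive

end

/-! ### Barycentric systems in terms of vertices and their parents. -/

section Support

variable {V W : Type*}

open Classical in
theorem support_simplicialExtension_barycentre (φ : V → W) {s : Finset V} (hs : s.Nonempty) :
    Function.support (simplicialExtension φ (barycentre s)) = s.image φ := by
  ext w
  rw [Function.mem_support, simplicialExtension, mem_support_affineExtension
    (barycentre_mem hs subset_rfl) (support_barycentre s)]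
  · simp only [Finset.coe_image, Set.mem_image, Finset.mem_coe]
    refine exists_congr fun u => and_congr_right fun _ => ?_
    by_cases h : w = φ u
    · subst h; simp [vertexPoint]
    · simp [vertexPoint, h, Ne.symm h]
  · intro u w
    by_cases h : w = φ u
    · subst h; simp [vertexPoint]
    · simp [vertexPoint, h]

end Support

namespace PolyhedralSystem

variable {A : PolyhedralSystem} {m : ℕ} {T : A.SimplexTypes (Fin m)}

open Classical in
/-- The simplex to whose barycentre the vertex `v` is mapped. -/
noncomputable def par (hB : A.IsBarycentric) (n : ℕ) (v : A.V (n + 1)) : Finset (A.V n) :=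
  if h : {v} ∈ (A.K (n + 1)).faces then
    (hB n v ⟨vertexPoint v, vertexPoint_mem_realization.2 h⟩ rfl).choose else ∅

theorem par_spec (hB : A.IsBarycentric) {n : ℕ} {v : A.V (n + 1)}
    (h : {v} ∈ (A.K (n + 1)).faces) : par hB n v ∈ (A.K n).faces ∧
      (A.f n ⟨vertexPoint v, vertexPoint_mem_realization.2 h⟩).1 = barycentre (par hB n v) := by
  rw [par, dif_pos h]
  exact (hB n v ⟨vertexPoint v, vertexPoint_mem_realization.2 h⟩ rfl).choose_spec

theorem isParent_iff (hB : A.IsBarycentric) {n : ℕ} {v : A.V (n + 1)} {s : Finset (A.V n)} :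
    (s ∈ (A.K n).faces ∧ ∃ p : realization (A.K (n + 1)),
      (p : A.V (n + 1) → ℝ) = vertexPoint v ∧ (A.f n p : A.V n → ℝ) = barycentre s) ↔
    {v} ∈ (A.K (n + 1)).faces ∧ s = par hB n v := by
  constructor
  · rintro ⟨_, ⟨p, hp⟩, rfl, h⟩
    have hv := vertexPoint_mem_realization.1 hp
    exact ⟨hv, barycentre_injective (h.symm.trans (par_spec hB hv).2)⟩
  · rintro ⟨hv, rfl⟩
    exact ⟨(par_spec hB hv).1, _, rfl, (par_spec hB hv).2⟩

theorem singleton_mem_faces {n : ℕ} {s : Finset (A.V n)} (hs : s ∈ (A.K n).faces) {v : A.V n}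
    (hv : v ∈ s) : {v} ∈ (A.K n).faces :=
  face_subset hs (by simpa using hv) (by simp)

/-- The bonding map is given as affine along segments, so its values on a simplex are controlled by
removing one vertex at a time. -/
theorem f_mem_closedSimplex (hA : A.IsAffineSystem) (hB : A.IsBarycentric) {n : ℕ}
    {σ : Finset (A.V (n + 1))} (hσ : σ ∈ (A.K (n + 1)).faces) {s : Finset (A.V n)}
    (hs : ∀ v ∈ σ, par hB n v ⊆ s) (τ : Finset (A.V (n + 1))) (hτ : τ ⊆ σ) :
    ∀ p : realization (A.K (n + 1)), p.1 ∈ closedSimplex τ → (A.f n p).1 ∈ closedSimplex s := by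
  classical
  induction τ using Finset.induction_on with
  | empty =>
    intro p hp
    have := hp.2.2
    simp at this
  | insert v τ hv ih =>
    intro p hp
    have hvσ : v ∈ σ := hτ (Finset.mem_insert_self _ _)
    have hvf := singleton_mem_faces hσ hvσ
    have hvm : (A.f n ⟨vertexPoint v, vertexPoint_mem_realization.2 hvf⟩).1 ∈ closedSimplex s := by
      rw [(par_spec hB hvf).2]
      exact barycentre_mem (face_nonempty (par_spec hB hvf).1) (hs v hvσ)
    have hsum := hp.2.2
    rw [Finset.sum_insert hv] at hsum
    have hτ0 : 0 ≤ ∑ u ∈ τ, p.1 u := Finset.sum_nonneg fun u _ => hp.1 u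
    by_cases h1 : p.1 v = 1
    · have hpv : p = ⟨vertexPoint v, vertexPoint_mem_realization.2 hvf⟩ := by
        refine Subtype.ext (funext fun u => ?_)
        by_cases hu : u = v
        · subst hu; simp [vertexPoint, h1]
        · have h0 : ∑ u ∈ τ, p.1 u = 0 := by linarith
          have h2 := (Finset.sum_eq_zero_iff_of_nonneg fun u _ => hp.1 u).1 h0
          simp only [vertexPoint, ne_eq, hu, not_false_eq_true, Pi.single_eq_of_ne]
          by_cases hut : u ∈ τ
          · exact h2 u hut
          · exact hp.2.1 u (by simp [hu, hut])
      rw [hpv]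
      exact hvm
    · have hlt : 0 < 1 - p.1 v := by
        have : p.1 v ≠ 1 := h1
        have h2 : p.1 v ≤ 1 := by linarith
        have := lt_of_le_of_ne h2 this
        linarith
      -- The projection of p from v to the opposite face, so that p divides the segment from q to v
      -- in the ratio given by its coordinate at v.
      let q : A.V (n + 1) → ℝ := fun u => if u = v then 0 else (1 - p.1 v)⁻¹ * p.1 u
      have hq : q ∈ closedSimplex τ := by
        refine ⟨fun u => ?_, fun u hu => ?_, ?_⟩
        · simp only [q]
          split_ifs
          · exact le_rfl
          · exact mul_nonneg (inv_nonneg.2 hlt.le) (hp.1 u)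
        · simp only [q]
          split_ifs with h
          · rfl
          · rw [hp.2.1 u (by simp [h, hu]), mul_zero]
        · have : ∑ u ∈ τ, q u = ∑ u ∈ τ, (1 - p.1 v)⁻¹ * p.1 u :=
            Finset.sum_congr rfl fun u hu => if_neg fun h : u = v => hv (h ▸ hu)
          rw [this, ← Finset.mul_sum, inv_mul_eq_div, div_eq_one_iff_eq hlt.ne']
          linarith
      have hτne : τ.Nonempty := by
        by_contra h
        rw [Finset.not_nonempty_iff_eq_empty] at h
        simp [h] at hsum
        exact h1 hsum
      have hτσ : τ ⊆ σ := (Finset.subset_insert _ _).trans hτ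
      have hqr := mem_realization_of_face (face_subset hσ hτσ hτne) hq
      have hqm := ih hτσ ⟨q, hqr⟩ hq
      have hconv := (hA n σ hσ).2 ⟨q, hqr⟩ ⟨vertexPoint v, vertexPoint_mem_realization.2 hvf⟩ p
        (p.1 v) (hp.1 v) (by linarith)
        (mem_closedSimplex_of_support hq ((support_subset_of_mem_closedSimplex hq).trans
          (Finset.coe_subset.2 hτσ)))
        (vertexPoint_mem hvσ) (by
          funext u
          simp only [Pi.add_apply, Pi.smul_apply, smul_eq_mul, q]
          by_cases hu : u = v
          · subst hu; simp [vertexPoint]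
          · simp only [hu, if_false, vertexPoint, ne_eq, not_false_eq_true, Pi.single_eq_of_ne,
              mul_zero, add_zero]
            rw [mul_inv_cancel_left₀ hlt.ne'])
      rw [hconv]
      exact convexComb_mem_closedSimplex hqm hvm (hp.1 v) (by linarith)

/-- This turns the geometric preimage into a condition that can be tested on codes. -/
theorem mem_preimageFaces_iff (hA : A.IsAffineSystem) (hB : A.IsBarycentric) {n : ℕ}
    {σ : Finset (A.V (n + 1))} {s : Finset (A.V n)} :
    σ ∈ preimageFaces (A.f n) s ↔ σ ∈ (A.K (n + 1)).faces ∧ ∀ v ∈ σ, par hB n v ⊆ s := by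
  refine and_congr_right fun hσ => ⟨fun h v hv => ?_, fun h => ?_⟩
  · have hvf := singleton_mem_faces hσ hv
    have h1 := h ⟨vertexPoint v, vertexPoint_mem_realization.2 hvf⟩ (vertexPoint_mem hv)
    rw [(par_spec hB hvf).2] at h1
    have := support_subset_of_mem_closedSimplex h1
    rwa [support_barycentre, Finset.coe_subset] at this
  · exact f_mem_closedSimplex hA hB hσ h σ subset_rfl

open Classical in
/-- The type of a simplex as a natural number, with junk value `0`. -/
noncomputable def typeNum (T : A.SimplexTypes (Fin m)) (n : ℕ) (σ : Finset (A.V n)) : ℕ :=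
  if h : σ ∈ (A.K n).faces then T n ⟨σ, h⟩ else 0

theorem typeNum_eq {n : ℕ} (s : (A.K n).faces) : typeNum T n s.1 = T n s := dif_pos s.2

open Classical in
/-- The ladder condition for the first two stages, in terms of vertices. -/
theorem exists_ladder_maps (hM : A.IsMarkov T) (hB : A.IsBarycentric) {i j : ℕ}
    (s : (A.K i).faces) (s' : (A.K j).faces) (h : T i s = T j s') :
    ∃ (φ : A.V i → A.V j) (ψ : A.V (i + 1) → A.V (j + 1)),
      s.1.image φ = s'.1 ∧
      (∀ w ∈ s.1, typeNum T j {φ w} = typeNum T i {w}) ∧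
      Set.BijOn (fun σ : Finset (A.V (i + 1)) => σ.image ψ) (preimageFaces (A.f i) s.1)
        (preimageFaces (A.f j) s'.1) ∧
      (∀ σ ∈ preimageFaces (A.f i) s.1, typeNum T (j + 1) (σ.image ψ) = typeNum T (i + 1) σ) ∧
      ∀ σ ∈ preimageFaces (A.f i) s.1, ∀ v ∈ σ, par hB j (ψ v) = (par hB i v).image φ := by
  obtain ⟨φ, hiso, htype, hcomm⟩ := hM.ladder i j s s' h
  -- The empty composition is the identity, so in stage 0 the preimage of a simplex consists of its
  -- own faces.
  have h0 : ∀ (l : ℕ) (t : (A.K l).faces) (σ : Finset (A.V l)),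
      σ ∈ preimageFaces (A.comp l 0) t.1 ↔ σ ⊆ t.1 ∧ σ.Nonempty := by
    intro l t σ
    constructor
    · intro hσ
      have hne := face_nonempty hσ.1
      have hb := barycentre_mem hne (subset_refl σ)
      have h1 := support_subset_of_mem_closedSimplex
        (hσ.2 ⟨barycentre σ, mem_realization_of_face hσ.1 hb⟩ hb)
      refine ⟨?_, hne⟩
      have h2 : Function.support (barycentre σ) ⊆ (t.1 : Set (A.V l)) := h1
      rwa [support_barycentre, Finset.coe_subset] at h2
    · rintro ⟨hsub, hne⟩
      refine ⟨face_subset t.2 hsub hne, fun p hp => mem_closedSimplex_of_support hp ?_⟩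
      exact (support_subset_of_mem_closedSimplex hp).trans (Finset.coe_subset.2 hsub)
  have hmaps := (hiso 0).2.mapsTo
  have hsurj := (hiso 0).2.surjOn
  have hT : ∀ k (σ : Finset (A.V (i + k))), σ ∈ preimageFaces (A.comp i k) s.1 →
      typeNum T (j + k) (σ.image (φ k)) = typeNum T (i + k) σ := by
    intro k σ hσ
    have := htype k ⟨σ, hσ.1⟩ ⟨_, ((hiso k).2.mapsTo hσ).1⟩ hσ rfl
    rw [typeNum_eq (T := T) ⟨σ, hσ.1⟩, typeNum_eq (T := T) ⟨_, ((hiso k).2.mapsTo hσ).1⟩, this]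
  refine ⟨φ 0, φ 1, ?_, fun w hw => ?_, (hiso 1).2, hT 1, ?_⟩
  · refine subset_antisymm ?_ ?_
    · exact ((h0 j s' _).1 (hmaps ((h0 i s s.1).2 ⟨subset_rfl, face_nonempty s.2⟩))).1
    · obtain ⟨σ, hσ, he⟩ := hsurj ((h0 j s' s'.1).2 ⟨subset_rfl, face_nonempty s'.2⟩)
      rw [← he]
      exact Finset.image_subset_image ((h0 i s σ).1 hσ).1
  · have := hT 0 {w} ((h0 i s {w}).2 ⟨by simpa using hw, by simp⟩)
    rwa [Finset.image_singleton] at this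
  · intro σ hσ v hv
    have hvf := singleton_mem_faces hσ.1 hv
    have hv1 : {v} ∈ preimageFaces (A.f i) s.1 := ⟨hvf, fun p hp => hσ.2 p
      (mem_closedSimplex_of_support hp ((support_subset_of_mem_closedSimplex hp).trans
        (Finset.coe_subset.2 (by simpa using hv))))⟩
    have hvf' : {φ 1 v} ∈ (A.K (j + 1)).faces := by
      have := ((hiso 1).2.mapsTo hv1).1
      simpa using this
    -- The commuting square at the vertex v compares two barycentres, and their supports are the
    -- parents.
    have hc := hcomm 0 ⟨vertexPoint v, vertexPoint_mem_realization.2 hvf⟩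
      ⟨vertexPoint (φ 1 v), vertexPoint_mem_realization.2 hvf'⟩
      (hv1.2 _ (vertexPoint_mem (by simp))) (affineExtension_vertexPoint (fun u => vertexPoint (φ 1 u)) v).symm
    have hc1 : barycentre (par hB j (φ 1 v)) =
        simplicialExtension (φ 0) (barycentre (par hB i v)) := by
      rw [← (par_spec hB hvf').2, ← (par_spec hB hvf).2]
      exact hc
    have hc2 := support_barycentre (par hB j (φ 1 v))
    rw [hc1, support_simplicialExtension_barycentre _ (face_nonempty (par_spec hB hvf).1)] at hc2
    exact (Finset.coe_injective hc2).symm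

/-- Vertices of a simplex of a later stage are distinguished by their types. -/
theorem eq_of_typeNum_eq (hM : A.IsMarkov T) (hD : A.HasDistinctTypes T) {n : ℕ}
    {s : Finset (A.V (n + 1))} (hs : s ∈ (A.K (n + 1)).faces) {v w : A.V (n + 1)} (hv : v ∈ s)
    (hw : w ∈ s) (h : typeNum T (n + 1) {v} = typeNum T (n + 1) {w}) : v = w := by
  -- All vertices of s lie over one simplex of the preceding stage, which is where distinct types
  -- can be used; hence the restriction to positive stages.
  obtain ⟨⟨t, ht, hst⟩, -⟩ := hM.affine n s hs
  have hsub : ∀ u ∈ s, {u} ∈ preimageFaces (A.f n) t := fun u hu =>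
    ⟨singleton_mem_faces hs hu, fun p hp => hst.2 p (mem_closedSimplex_of_support hp
      ((support_subset_of_mem_closedSimplex hp).trans (Finset.coe_subset.2 (by simpa using hu))))⟩
  rw [typeNum_eq ⟨{v}, singleton_mem_faces hs hv⟩, typeNum_eq ⟨{w}, singleton_mem_faces hs hw⟩] at h
  have := hD n ⟨t, ht⟩ ⟨{v}, singleton_mem_faces hs hv⟩ ⟨{w}, singleton_mem_faces hs hw⟩
    (hsub v hv) (hsub w hw) (Fin.ext h)
  simpa using congrArg Subtype.val this

end PolyhedralSystem

/-! ### Reading simplexes, types and parents from codes. -/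

section Canonical

theorem mem_canon {l : List ℕ} {x : ℕ} : x ∈ canon l ↔ x ∈ l := by
  simp only [canon, List.mem_filter, List.mem_range, decide_eq_true_eq, and_iff_right_iff_imp]
  exact fun h => Nat.lt_succ_of_le (List.le_sum_of_mem h)

/-- A new label must depend on the set of parent labels alone, not on the list by which a block
presents it. -/
theorem canon_eq_iff {l l' : List ℕ} : canon l = canon l' ↔ l.toFinset = l'.toFinset := by
  refine ⟨fun h => ?_, fun h => ?_⟩
  · ext x
    rw [List.mem_toFinset, List.mem_toFinset, ← mem_canon, h, mem_canon]
  · have hs : ∀ l : List ℕ, (canon l).SortedLT := fun l =>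
      ((List.pairwise_lt_range).filter _).sortedLT
    refine List.Perm.eq_of_pairwise (le := (· < ·)) ?_ (hs l).pairwise (hs l').pairwise ?_
    · intro a b _ _ h1 h2
      exact absurd h1 h2.asymm
    · rw [List.perm_ext_iff_of_nodup (hs l).nodup (hs l').nodup]
      intro x
      rw [mem_canon, mem_canon, ← List.mem_toFinset, h, List.mem_toFinset]

theorem isSingle_iff {x : ℕ} {e : List ℕ × ℕ} : IsSingle x e ↔ e.1.toFinset = {x} := by
  rw [Finset.eq_singleton_iff_nonempty_unique_mem, List.toFinset_nonempty_iff, IsSingle]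
  simp

end Canonical

namespace PolyhedralSystem

variable {A : PolyhedralSystem} {m : ℕ} {T : A.SimplexTypes (Fin m)} {ν ν' : ∀ n, A.V n → ℕ}
  {n : ℕ} {C : StageCode}

theorem codesParents_iff (hB : A.IsBarycentric) {l : List (ℕ × List ℕ)} :
    A.CodesParents ν n l ↔
      (∀ v, {v} ∈ (A.K (n + 1)).faces → ∃ e ∈ l, e.1 = ν (n + 1) v ∧
        e.2.toFinset = (par hB n v).image (ν n)) ∧
      ∀ e ∈ l, ∃ v, {v} ∈ (A.K (n + 1)).faces ∧ e.1 = ν (n + 1) v ∧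
        e.2.toFinset = (par hB n v).image (ν n) := by
  unfold CodesParents
  simp only [isParent_iff hB]
  constructor
  · rintro ⟨h1, h2⟩
    refine ⟨fun v hv => h1 v _ ⟨hv, rfl⟩, fun e he => ?_⟩
    obtain ⟨v, s, ⟨hv, rfl⟩, h⟩ := h2 e he
    exact ⟨v, hv, h⟩
  · rintro ⟨h1, h2⟩
    refine ⟨?_, fun e he => ?_⟩
    · rintro v s ⟨hv, rfl⟩
      exact h1 v hv
    · obtain ⟨v, hv, h⟩ := h2 e he
      exact ⟨v, _, ⟨hv, rfl⟩, h⟩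

theorem CodesStage.congr (h : ∀ k ≤ n, ν k = ν' k) (hC : A.CodesStage T ν n C) :
    A.CodesStage T ν' n C := by
  cases n with
  | zero =>
    unfold CodesStage at *
    rwa [← h 0 le_rfl]
  | succ n =>
    unfold CodesStage CodesParents at *
    simp only [← h (n + 1) le_rfl, ← h n (Nat.le_succ n)]
    exact hC

theorem image_subset_image_iff {V : Type*} {f : V → ℕ} {P : Set V} (hf : Set.InjOn f P)
    {s t : Finset V} (hs : (s : Set V) ⊆ P) (ht : (t : Set V) ⊆ P) :
    s.image f ⊆ t.image f ↔ s ⊆ t := by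
  refine ⟨fun h v hv => ?_, fun h => Finset.image_subset_image h⟩
  obtain ⟨w, hw, he⟩ := Finset.mem_image.1 (h (Finset.mem_image_of_mem f hv))
  rwa [← hf (ht hw) (hs hv) he]

theorem image_inj_iff {V : Type*} {f : V → ℕ} {P : Set V} (hf : Set.InjOn f P)
    {s t : Finset V} (hs : (s : Set V) ⊆ P) (ht : (t : Set V) ⊆ P) :
    s.image f = t.image f ↔ s = t := by
  simp only [subset_antisymm_iff, ← image_subset_image_iff hf hs ht,
    ← image_subset_image_iff hf ht hs]

theorem coe_face_subset {s : Finset (A.V n)} (hs : s ∈ (A.K n).faces) :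
    (s : Set (A.V n)) ⊆ {v | {v} ∈ (A.K n).faces} := fun _ hv => singleton_mem_faces hs hv

theorem CodesStage.exists_face (hC : A.CodesStage T ν n C) {e : List ℕ × ℕ} (he : e ∈ C.1) :
    ∃ s : (A.K n).faces, e.1.toFinset = s.1.image (ν n) ∧ e.2 = typeNum T n s.1 := by
  obtain ⟨s, h1, h2⟩ := hC.2.2.1 e he
  exact ⟨s, h1, by rw [h2, typeNum_eq]⟩

theorem CodesStage.exists_entry (hC : A.CodesStage T ν n C) {s : Finset (A.V n)}
    (hs : s ∈ (A.K n).faces) :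
    ∃ e ∈ C.1, e.1.toFinset = s.image (ν n) ∧ e.2 = typeNum T n s := by
  obtain ⟨e, he, h1, h2⟩ := hC.2.1 ⟨s, hs⟩
  exact ⟨e, he, h1, by rw [h2, ← typeNum_eq]⟩

theorem CodesStage.exists_single (hC : A.CodesStage T ν n C) {v : A.V n}
    (hv : {v} ∈ (A.K n).faces) : ∃ e ∈ C.1, IsSingle (ν n v) e ∧ e.2 = typeNum T n {v} := by
  obtain ⟨e, he, h1, h2⟩ := hC.exists_entry hv
  exact ⟨e, he, isSingle_iff.2 (by simpa using h1), h2⟩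

theorem CodesStage.type_of_single (hC : A.CodesStage T ν n C) {v : A.V n}
    (hv : {v} ∈ (A.K n).faces) {e : List ℕ × ℕ} (he : e ∈ C.1) (hs : IsSingle (ν n v) e) :
    e.2 = typeNum T n {v} := by
  obtain ⟨s, h1, h2⟩ := hC.exists_face he
  rw [isSingle_iff, h1, ← Finset.image_singleton,
    image_inj_iff hC.1 (coe_face_subset s.2) (coe_face_subset hv)] at hs
  rw [h2, hs]

/-- A code may list the simplex {v} repeatedly, but always with the same type, so the head of the
filtered list is as good as any entry. -/
theorem CodesStage.vertexType_eq (hC : A.CodesStage T ν n C) {v : A.V n}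
    (hv : {v} ∈ (A.K n).faces) : vertexType C (ν n v) = typeNum T n {v} := by
  classical
  obtain ⟨e, he, h1, h2⟩ := hC.exists_single hv
  unfold vertexType
  set l := C.1.filter (IsSingle (ν n v) ·) with hl
  have hel : e ∈ l := by simp [hl, he, h1]
  match hlc : l with
  | [] => simp at hel
  | a :: l' =>
    have ha : a ∈ C.1.filter (IsSingle (ν n v) ·) := by rw [← hl]; simp
    rw [List.mem_filter, decide_eq_true_eq] at ha
    exact hC.type_of_single hv ha.1 ha.2

theorem sameVertexType_iff {k : ℕ} {P : StageCode} (hP : A.CodesStage T ν n P)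
    (hC : A.CodesStage T ν' k C) {v : A.V n} (hv : {v} ∈ (A.K n).faces) {w : A.V k}
    (hw : {w} ∈ (A.K k).faces) :
    SameVertexType P (ν n v) C (ν' k w) ↔ typeNum T n {v} = typeNum T k {w} := by
  constructor
  · rintro ⟨e, he, e', he', h1, h2, h3⟩
    rw [← hP.type_of_single hv he h1, ← hC.type_of_single hw he' h2, h3]
  · intro h
    obtain ⟨e, he, h1, h2⟩ := hP.exists_single hv
    obtain ⟨e', he', h1', h2'⟩ := hC.exists_single hw
    exact ⟨e, he, e', he', h1, h1', by rw [h2, h2', h]⟩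

theorem CodesStage.parentLabels_eq (hB : A.IsBarycentric) (hC : A.CodesStage T ν (n + 1) C)
    {v : A.V (n + 1)} (hv : {v} ∈ (A.K (n + 1)).faces) :
    (parentLabels C (ν (n + 1) v)).toFinset = (par hB n v).image (ν n) := by
  classical
  obtain ⟨h1, h2⟩ := (codesParents_iff hB).1 (show A.CodesParents ν n C.2 from hC.2.2.2)
  ext x
  simp only [parentLabels, List.mem_toFinset, List.mem_flatMap, List.mem_filter,
    decide_eq_true_eq]
  constructor
  · rintro ⟨e, ⟨he, hev⟩, hx⟩
    obtain ⟨w, hw, h3, h4⟩ := h2 e he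
    obtain rfl : w = v := hC.1 hw hv (h3.symm.trans hev)
    rw [← h4, List.mem_toFinset]
    exact hx
  · intro hx
    obtain ⟨e, he, h3, h4⟩ := h1 v hv
    rw [← h4, List.mem_toFinset] at hx
    exact ⟨e, ⟨he, h3⟩, hx⟩

/-! ### Correctness of one rebuilding step. -/

section Step

variable {ν₀ : ∀ n, A.V n → ℕ} {c : List StageCode} {N : ℕ} {P : StageCode}

/-- The block `B` serves to lift the simplex `s`. -/
def IsBlock (T : A.SimplexTypes (Fin m)) (ν ν₀ : ∀ n, A.V n → ℕ) (c : List StageCode) (N n : ℕ)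
    (s : (A.K n).faces) (B : Block) : Prop :=
  ∃ k ≤ N, ∃ s' : (A.K k).faces, T n s = T k s' ∧
    B.1 = (c.getD k ([], []), c.getD (k + 1) ([], [])) ∧
    B.2.1.toFinset = s.1.image (ν n) ∧ B.2.2.toFinset = s'.1.image (ν₀ k)

theorem mem_blocks {B : Block} : B ∈ blocks c P ↔ ∃ k < c.length - 1, ∃ e ∈ P.1,
    ∃ e' ∈ (c.getD k ([], [])).1, e'.2 = e.2 ∧
      B = ((c.getD k ([], []), c.getD (k + 1) ([], [])), (e.1, e'.1)) := by
  classical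
  simp only [blocks, List.mem_flatMap, List.mem_range, List.mem_map, List.mem_filter,
    decide_eq_true_eq, and_assoc, eq_comm (b := B)]

variable (hclen : c.length = N + 2)
  (hc : ∀ k ≤ N + 1, A.CodesStage T ν₀ k (c.getD k ([], []))) (hP : A.CodesStage T ν n P)

include hclen hc hP in
theorem isBlock_of_mem {B : Block} (hB : B ∈ blocks c P) :
    ∃ s, IsBlock T ν ν₀ c N n s B := by
  obtain ⟨k, hk, e, he, e', he', ht, rfl⟩ := mem_blocks.1 hB
  obtain ⟨s, h1, h2⟩ := hP.exists_face he
  obtain ⟨s', h1', h2'⟩ := (hc k (by omega)).exists_face he'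
  refine ⟨s, k, by omega, s', ?_, rfl, h1, h1'⟩
  rw [h2, h2', typeNum_eq, typeNum_eq] at ht
  exact Fin.ext ht.symm

include hclen hc hP in
theorem exists_isBlock (hT : A.AllTypesUpTo T N) (s : (A.K n).faces) :
    ∃ B ∈ blocks c P, IsBlock T ν ν₀ c N n s B := by
  obtain ⟨k, hk, s', hs'⟩ := hT n s
  obtain ⟨e, he, h1, h2⟩ := hP.exists_entry s.2
  obtain ⟨e', he', h1', h2'⟩ := (hc k (by omega)).exists_entry s'.2
  refine ⟨_, mem_blocks.2 ⟨k, by omega, e, he, e', he', ?_, rfl⟩, k, hk, s', hs'.symm, rfl, h1, h1'⟩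
  rw [h2, h2', typeNum_eq, typeNum_eq, hs']

/-- The label `x` of a model vertex gives rise to the vertex `v`. -/
def Models (hB : A.IsBarycentric) (T : A.SimplexTypes (Fin m)) (ν : ∀ n, A.V n → ℕ) (P : StageCode)
    (n : ℕ) (B : Block) (x : ℕ) (v : A.V (n + 1)) : Prop :=
  (newParent P B x).toFinset = (par hB n v).image (ν n) ∧
    vertexType B.1.2 x = typeNum T (n + 1) {v}

/-- The entry `e` for a model simplex gives rise to the simplex `σ`. -/
def ModelsSimplex (hB : A.IsBarycentric) (T : A.SimplexTypes (Fin m)) (ν : ∀ n, A.V n → ℕ)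
    (P : StageCode) (n : ℕ) (B : Block) (e : List ℕ × ℕ) (σ : Finset (A.V (n + 1))) : Prop :=
  e.2 = typeNum T (n + 1) σ ∧ (∀ x ∈ e.1, ∃ v ∈ σ, Models hB T ν P n B x v) ∧
    ∀ v ∈ σ, ∃ x ∈ e.1, Models hB T ν P n B x v

-- The ladder between s and its model s' matches the simplexes over s with those over s', and the
-- latter are listed in the known stage k + 1. Parent labels are carried back through vertex types,
-- which are injective on the vertices of s because n > 0.
include hc hP in
theorem IsBlock.spec (hM : A.IsMarkov T) (hB : A.IsBarycentric) (hD : A.HasDistinctTypes T)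
    (hn : 0 < n) {s : (A.K n).faces} {B : Block} (h : IsBlock T ν ν₀ c N n s B) :
    (∀ σ ∈ preimageFaces (A.f n) s.1, ∃ e ∈ liftable B, ModelsSimplex hB T ν P n B e σ) ∧
    ∀ e ∈ liftable B, ∃ σ ∈ preimageFaces (A.f n) s.1, ModelsSimplex hB T ν P n B e σ := by
  classical
  obtain ⟨k, hk, s', hT, hB1, hs, hs'⟩ := h
  obtain ⟨⟨C, C'⟩, l, l'⟩ := B
  obtain ⟨rfl, rfl⟩ := Prod.mk.inj hB1
  simp only at hs hs'
  have hC := hc k (by omega)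
  have hC' := hc (k + 1) (by omega)
  obtain ⟨φ, ψ, hφ, hφT, hψ, hψT, hpar⟩ := exists_ladder_maps hM hB s s' hT
  have hφv : ∀ w ∈ s.1, {φ w} ∈ (A.K k).faces := fun w hw =>
    singleton_mem_faces s'.2 (hφ ▸ Finset.mem_image_of_mem φ hw)
  have hiff : ∀ σ', σ' ∈ preimageFaces (A.f k) s'.1 ↔ σ' ∈ (A.K (k + 1)).faces ∧
      ∀ v ∈ σ', par hB k v ⊆ s'.1 := fun σ' => mem_preimageFaces_iff hM.affine hB
  have hmodel : ∀ σ ∈ preimageFaces (A.f n) s.1, ∀ v ∈ σ, Models hB T ν P n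
      ((c.getD k ([], []), c.getD (k + 1) ([], [])), l, l') (ν₀ (k + 1) (ψ v)) v := by
    intro σ hσ v hv
    have hvσ := singleton_mem_faces hσ.1 hv
    have hψv : {ψ v} ∈ (A.K (k + 1)).faces :=
      singleton_mem_faces (hψ.mapsTo hσ).1 (Finset.mem_image_of_mem ψ hv)
    have hpv := ((mem_preimageFaces_iff hM.affine hB).1 hσ).2 v hv
    refine ⟨?_, ?_⟩
    · ext x
      simp only [newParent, translate, List.mem_toFinset, List.mem_filter, decide_eq_true_eq]
      have hmem : ∀ y, y ∈ parentLabels (c.getD (k + 1) ([], [])) (ν₀ (k + 1) (ψ v)) ↔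
          ∃ w ∈ par hB n v, ν₀ k (φ w) = y := by
        intro y
        rw [← List.mem_toFinset, hC'.parentLabels_eq hB hψv, hpar σ hσ v hv]
        simp
      have hl : ∀ y, y ∈ l ↔ ∃ w ∈ s.1, ν n w = y := by
        intro y
        rw [← List.mem_toFinset, hs]
        simp
      simp only [hmem, hl, Finset.mem_image]
      constructor
      · rintro ⟨⟨w, hw, rfl⟩, y, ⟨u, hu, rfl⟩, hsame⟩
        rw [sameVertexType_iff hP hC (singleton_mem_faces s.2 hw) (hφv u (hpv hu)),
          hφT u (hpv hu)] at hsame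
        obtain ⟨n, rfl⟩ := Nat.exists_eq_succ_of_ne_zero hn.ne'
        obtain rfl := eq_of_typeNum_eq hM hD s.2 hw (hpv hu) hsame
        exact ⟨w, hu, rfl⟩
      · rintro ⟨w, hw, rfl⟩
        refine ⟨⟨w, hpv hw, rfl⟩, _, ⟨w, hw, rfl⟩, ?_⟩
        rw [sameVertexType_iff hP hC (singleton_mem_faces s.2 (hpv hw)) (hφv w (hpv hw)),
          hφT w (hpv hw)]
    · have hv1 : {v} ∈ preimageFaces (A.f n) s.1 :=
        (mem_preimageFaces_iff hM.affine hB).2 ⟨hvσ, by simpa using hpv⟩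
      have := hψT _ hv1
      rw [Finset.image_singleton] at this
      rw [← this]
      exact hC'.vertexType_eq hψv
  have hsimplex : ∀ σ ∈ preimageFaces (A.f n) s.1, ∀ e : List ℕ × ℕ,
      e.1.toFinset = (σ.image ψ).image (ν₀ (k + 1)) → e.2 = typeNum T (k + 1) (σ.image ψ) →
      ModelsSimplex hB T ν P n ((c.getD k ([], []), c.getD (k + 1) ([], [])), l, l') e σ := by
    intro σ hσ e he1 he2
    have hmem : ∀ y, y ∈ e.1 ↔ ∃ v ∈ σ, ν₀ (k + 1) (ψ v) = y := by
      intro y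
      rw [← List.mem_toFinset, he1]
      simp
    refine ⟨by rw [he2, hψT σ hσ], fun x hx => ?_, fun v hv => ?_⟩
    · obtain ⟨v, hv, rfl⟩ := (hmem x).1 hx
      exact ⟨v, hv, hmodel σ hσ v hv⟩
    · exact ⟨_, (hmem _).2 ⟨v, hv, rfl⟩, hmodel σ hσ v hv⟩
  have hlift : ∀ e ∈ (c.getD (k + 1) ([], [])).1, ∀ σ' ∈ (A.K (k + 1)).faces,
      e.1.toFinset = σ'.image (ν₀ (k + 1)) →
      ((∀ x ∈ e.1, ∀ y ∈ parentLabels (c.getD (k + 1) ([], [])) x, y ∈ l') ↔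
        ∀ v ∈ σ', par hB k v ⊆ s'.1) := by
    intro e _ σ' hσ' heσ
    have hmem : ∀ y, y ∈ e.1 ↔ ∃ v ∈ σ', ν₀ (k + 1) v = y := by
      intro y
      rw [← List.mem_toFinset, heσ]
      simp
    simp only [hmem, forall_exists_index, and_imp, forall_apply_eq_imp_iff₂]
    refine forall₂_congr fun v hv => ?_
    have hvf := singleton_mem_faces hσ' hv
    rw [← image_subset_image_iff hC.1 (coe_face_subset (par_spec hB hvf).1)
      (coe_face_subset s'.2), ← hC'.parentLabels_eq hB hvf, ← hs']
    simp [Finset.subset_iff]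
  constructor
  · intro σ hσ
    have hσ' := hψ.mapsTo hσ
    obtain ⟨e, he, h1, h2⟩ := hC'.exists_entry hσ'.1
    refine ⟨e, ?_, hsimplex σ hσ e h1 h2⟩
    rw [liftable, List.mem_filter, decide_eq_true_eq]
    exact ⟨he, (hlift e he _ hσ'.1 h1).2 ((hiff _).1 hσ').2⟩
  · intro e he
    rw [liftable, List.mem_filter, decide_eq_true_eq] at he
    obtain ⟨σ', h1, h2⟩ := hC'.exists_face he.1
    have hσ' := (hiff _).2 ⟨σ'.2, (hlift e he.1 _ σ'.2 h1).1 he.2⟩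
    obtain ⟨σ, hσ, hσe⟩ := hψ.surjOn hσ'
    simp only at hσe
    exact ⟨σ, hσ, hsimplex σ hσ e (by rw [hσe, h1]) (by rw [hσe, h2])⟩

-- Every simplex of the next stage lies over some s and so arises from a block, and every entry
-- produced comes from such a simplex. The labels are intrinsic, so the blocks need no gluing; their
-- injectivity is the distinct types property over the common parent.
include hclen hc hP in
theorem codesStage_nextStage (hM : A.IsMarkov T) (hB : A.IsBarycentric) (hD : A.HasDistinctTypes T)
    (hT : A.AllTypesUpTo T N) (hn : 0 < n)
    (hν : ∀ v, ν (n + 1) v = Nat.pair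
      (Encodable.encode (canon ((par hB n v).image (ν n)).toList)) (typeNum T (n + 1) {v})) :
    A.CodesStage T ν (n + 1) (nextStage c P) := by
  classical
  have hlabel : ∀ {B x v}, Models hB T ν P n B x v → newLabel P B x = ν (n + 1) v := by
    rintro B x v ⟨h1, h2⟩
    rw [hν, newLabel, h2, canon_eq_iff.2 (h1.trans (Finset.toList_toFinset _).symm)]
  have hsimp : ∀ {B e σ}, ModelsSimplex hB T ν P n B e σ →
      (e.1.map (newLabel P B)).toFinset = σ.image (ν (n + 1)) := by
    rintro B e σ ⟨-, h1, h2⟩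
    ext y
    simp only [List.mem_toFinset, List.mem_map, Finset.mem_image]
    constructor
    · rintro ⟨x, hx, rfl⟩
      obtain ⟨v, hv, h⟩ := h1 x hx
      exact ⟨v, hv, (hlabel h).symm⟩
    · rintro ⟨v, hv, rfl⟩
      obtain ⟨x, hx, h⟩ := h2 v hv
      exact ⟨x, hx, hlabel h⟩
  have hspec := fun {s B} (h : IsBlock T ν ν₀ c N n s B) => h.spec hc hP hM hB hD hn
  refine ⟨?_, ?_, ?_, ?_⟩
  · intro v hv w hw h
    rw [hν, hν, Nat.pair_eq_pair, Encodable.encode_inj, canon_eq_iff, Finset.toList_toFinset,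
      Finset.toList_toFinset, image_inj_iff hP.1 (coe_face_subset (par_spec hB hv).1)
      (coe_face_subset (par_spec hB hw).1)] at h
    obtain ⟨h1, h2⟩ := h
    rw [typeNum_eq ⟨{v}, hv⟩, typeNum_eq ⟨{w}, hw⟩] at h2
    have := hD n ⟨_, (par_spec hB hv).1⟩ ⟨{v}, hv⟩ ⟨{w}, hw⟩
      ((mem_preimageFaces_iff hM.affine hB).2 ⟨hv, by simp⟩)
      ((mem_preimageFaces_iff hM.affine hB).2 ⟨hw, by simp [h1]⟩) (Fin.ext h2)
    simpa using congrArg Subtype.val this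
  · intro σ
    obtain ⟨⟨s, hs, hσs⟩, -⟩ := hM.affine n σ.1 σ.2
    obtain ⟨B, hBm, hBs⟩ := exists_isBlock hclen hc hP hT ⟨s, hs⟩
    obtain ⟨e, he, hm⟩ := (hspec hBs).1 _ hσs
    refine ⟨_, List.mem_flatMap.2 ⟨B, hBm, List.mem_map_of_mem he⟩, hsimp hm, ?_⟩
    rw [← typeNum_eq]
    exact hm.1
  · intro a ha
    obtain ⟨B, hBm, ha⟩ := List.mem_flatMap.1 ha
    obtain ⟨e, he, rfl⟩ := List.mem_map.1 ha
    obtain ⟨s, hs⟩ := isBlock_of_mem hclen hc hP hBm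
    obtain ⟨σ, hσ, hm⟩ := (hspec hs).2 e he
    refine ⟨⟨σ, hσ.1⟩, hsimp hm, ?_⟩
    rw [← typeNum_eq]
    exact hm.1
  · refine (codesParents_iff hB).2 ⟨fun v hv => ?_, fun a ha => ?_⟩
    · have hp := (par_spec hB hv).1
      obtain ⟨B, hBm, hBs⟩ := exists_isBlock hclen hc hP hT ⟨_, hp⟩
      obtain ⟨e, he, hm⟩ := (hspec hBs).1 {v}
        ((mem_preimageFaces_iff hM.affine hB).2 ⟨hv, by simp⟩)
      obtain ⟨x, hx, hxv⟩ := hm.2.2 v (by simp)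
      exact ⟨_, List.mem_flatMap.2 ⟨B, hBm, List.mem_flatMap.2 ⟨e, he, List.mem_map_of_mem hx⟩⟩,
        hlabel hxv, hxv.1⟩
    · obtain ⟨B, hBm, ha⟩ := List.mem_flatMap.1 ha
      obtain ⟨e, he, ha⟩ := List.mem_flatMap.1 ha
      obtain ⟨x, hx, rfl⟩ := List.mem_map.1 ha
      obtain ⟨s, hs⟩ := isBlock_of_mem hclen hc hP hBm
      obtain ⟨σ, hσ, hm⟩ := (hspec hs).2 e he
      obtain ⟨v, hv, hxv⟩ := hm.2.1 x hx
      exact ⟨v, singleton_mem_faces hσ.1 hv, hlabel hxv, hxv.1⟩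

end Step

open Classical in
/-- The labels of the vertices in the rebuilt stages. -/
noncomputable def rebuiltLabels (hB : A.IsBarycentric) (T : A.SimplexTypes (Fin m))
    (ν₀ : ∀ n, A.V n → ℕ) (N : ℕ) : ∀ n, A.V n → ℕ
  | 0 => ν₀ 0
  | n + 1 => if n ≤ N then ν₀ (n + 1) else fun v => Nat.pair
      (Encodable.encode (canon ((par hB n v).image (rebuiltLabels hB T ν₀ N n)).toList))
      (typeNum T (n + 1) {v})

/-- Every system is finitely describable. -/
theorem finitelyDescribable {A : PolyhedralSystem} {m : ℕ} (T : A.SimplexTypes (Fin m)) :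
    A.FinitelyDescribable T := by
  refine ⟨rebuild, computable_rebuild, ?_⟩
  intro N _ c hclen _ B m' T' hM hB hD hT ν₀ hc
  have hc' : ∀ k ≤ N + 1, B.CodesStage T' ν₀ k (c.getD k ([], [])) := by
    intro k hk
    have hk' : k < c.length := by omega
    have := hc k hk'
    rw [List.getD_eq_getElem _ _ hk']
    exact this
  have hν : ∀ n ≤ N + 1, rebuiltLabels hB T' ν₀ N n = ν₀ n := by
    intro n hn
    cases n with
    | zero => rfl
    | succ n => rw [rebuiltLabels, if_pos (by omega)]
  refine ⟨rebuiltLabels hB T' ν₀ N, fun n hn v _ => by rw [hν n hn], fun n => ?_⟩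
  induction n with
  | zero => exact (hc' 0 (by omega)).congr fun k hk => (hν k (by omega)).symm
  | succ n ih =>
    rw [rebuild]
    split_ifs with h
    · exact (hc' (n + 1) (by omega)).congr fun k hk => (hν k (by omega)).symm
    -- Here n ≥ N + 1, so n is positive, as the step requires.
    · refine codesStage_nextStage hclen hc' ih hM hB hD hT (by omega) fun v => ?_
      rw [rebuiltLabels, if_neg (by omega)]

end PolyhedralSystem

end MarkovNerve

/-! ### The main theorem. -/

theorem mainTheorem5 {G : Type*} [Group G] {Q : ℕ} (S : Fin Q → G) (hS : IsSymmetricGenerating S)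
    (δ : ℝ) (hδ : 1 ≤ δ) (hG : IsHyperbolic S δ) :
    ∃ N₁ : ℕ, ∀ N ≥ N₁, ∀ M : ℕ, (N : ℝ) + 4 * δ ≤ M → 14 * δ ≤ M →
      cousinRadius S δ / 2 + 4 * δ ≤ M → ∀ c : TypeChoices S N M,
      ∀ {X : Type*} [MetricSpace X] [CompactSpace X] [MulAction G X] [ContinuousConstSMul G X]
        (U : G → Set X) {𝒯 : Type*} (T : G → 𝒯) (D : ℝ) (J : ℕ)
        (hU : IsQuasiInvariant S U T D J), IsSystemOfCovers S U → D ≤ 16 * δ →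
        (∀ x y, T x = T y → bType δ c x = bType δ c y) →
        ∀ (L : ℕ) (hL : 0 < L) (hJ : J ∣ L),
          ∃ (m : ℕ) (T' : (coverNerveSystem hS hU hL hJ).SimplexTypes (Fin m)),
            (∀ n n' (s : ((coverNerveSystem hS hU hL hJ).K n).faces)
              (s' : ((coverNerveSystem hS hU hL hJ).K n').faces),
              T' n s = T' n' s' → SimilarSimplexes S U T (n * L) (n' * L) s.1 s'.1) ∧
            (coverNerveSystem hS hU hL hJ).IsMarkov T' ∧
            (coverNerveSystem hS hU hL hJ).HasDistinctTypes T' ∧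
            (coverNerveSystem hS hU hL hJ).IsBarycentric ∧
            (coverNerveSystem hS hU hL hJ).FinitelyDescribable T' := by
  set K := {g : G | (len S g : ℝ) ≤ 6 * δ + 1}.ncard
  -- The summand 2 + 2δ lets ball types determine cones. The summand 16δK puts the first K powers of
  -- an element of length at most 16δ inside the ball of radius N, where K is the pigeonhole number.
  refine ⟨⌈2 + 2 * δ + 16 * δ * K⌉₊, fun N hN M hM hM' _ c X _ _ _ _ U 𝒯 T D J hU _ hD hTB L hL hJ => ?_⟩
  have hN' : 2 + 2 * δ + 16 * δ * K ≤ N := Nat.ceil_le.1 hN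
  have hK : 0 ≤ 16 * δ * K := by positivity
  have hM0 : 0 < M := by
    have : (0 : ℝ) < M := by linarith
    exact_mod_cast this
  obtain ⟨m, T', h1, h2, h3⟩ := exists_markov_types hS hU hL hJ fun x γ hlen hT hd => by
    -- Shifts multiply on the left, rigidity concerns multiplication on the right; conjugation by x
    -- passes from one to the other.
    have hx : x * (x⁻¹ * γ * x) = γ * x := by group
    have ht : x⁻¹ * γ * x = 1 := eq_one_of_bType_eq hS hG (by linarith) le_rfl (by linarith) hM0 c
      (x := x) (by rw [hx, hlen]) (by rw [mul_assoc]; exact hd.trans hD)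
      (by rw [hx]; exact (hTB _ _ hT).symm)
    rw [ht, mul_one] at hx
    simpa using hx.symm
  exact ⟨m, T', h1, h2, h3, nerveSystem_isBarycentric _ _ _,
    PolyhedralSystem.finitelyDescribable T'⟩
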